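/- **Conventions.** A *three-dimensional RKHS* $H$ is a three-dimensional complex inner product space (inner product linear in the first argument) with a distinguished basis $k_1,k_2,k_3$ of *reproducing kernels* indexed by the points of $X=X(H)=\{x_1,x_2,x_3\}$, such that $k_{ij}:=\langle k_i,k_j\rangle\neq 0$ for all $i,j$; $h\in H$ is regarded as a function on $X$ by $h(x_i)=\langle h,k_i\rangle$. Put $\hat k_i=k_i/\|k_i\|$, $\widehat{k_{ij}}=\langle\hat k_i,\hat k_j\rangle$, and $$\delta_{ij}=\delta_H(x_i,x_j)=\sqrt{1-|\widehat{k_{ij}}|^2},\qquad A_{123}=\arg(k_{12}k_{23}k_{31})\in(-\pi,\pi],\qquad LF_{123}^2=\frac1{\delta_{12}^2}\left|1-\frac{k_{21}k_{13}}{k_{23}k_{11}}\right|^2 .$$ A *multiplier* with symbol $m:X\to\mathbb C$ is the operator $M_m$ on $H$ with $(M_mh)(x)=m(x)h(x)$, with the operator norm, and $$\delta_G(x,y)=\sup\{\operatorname{Re}m(x): m(y)=0,\ \|M_m\|\le 1\}.$$ For $Y\subset X$ let $H_Y$ be the span of the $k_y$, $y\in Y$, as an RKHS on $Y$. $H$ has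 the *Pick property* if for every $Y\subset X$ every multiplier of norm one on $H_Y$ is the restriction (of symbols) of a multiplier of norm one on $H$; it has the *complete Pick property* (CPP) if for all $p,q$ the same holds for multipliers $H_Y\otimes\mathbb C^q\to H_Y\otimes\mathbb C^p$ with $p\times q$ matrix-valued symbols. $DA_n$ is the RKHS on the unit ball $\mathbb B^n\subset\mathbb C^n$ with kernels $k_z(\zeta)=(1-\langle\zeta,z\rangle)^{-1}$. For an injective map $\Phi:X\to\mathbb B^n$, $DA_n(\Phi(X))$ is the span of the kernels of the points of $\Phi(X)$, as an RKHS on $\Phi(X)$. $H'$ is a *rescaling* of $H$, $H\sim H'$, if (with points of $X(H)$ and $X(H')$ matched in order) there are nonzero $\gamma_i\in\mathbb C$ with $k'_{ij}=\gamma_i\overline{\gamma_j}k_{ij}$; in $H\sim DA_n(\Phi(X))$ the point $x_i$ is matched with $\Phi(x_i)$. Two ordered triples in $\mathbb B^n$ are *congruent* if a holomorphic automorphism of $\mathbb B^n$ takes one to the other, respecting the order. **Theorem.** Let $H$ be a three-dimensional RKHS, $X(H)=\{x_1,x_2,x_3\}$. The following are equivalent: 1. $H$ has the complete Pick property. 2.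 $H$ has the Pick property. 3. There are $i\ne j$ with $\delta_H(x_i,x_j)=\delta_G(x_i,x_j)$. 4. $LF_{123}^2\le\delta_{13}^2$. 5. $$\frac1{|\widehat{k_{12}}|^2}+\frac1{|\widehat{k_{23}}|^2}+\frac1{|\widehat{k_{13}}|^2}-1\le\frac{2\cos A_{123}}{|\widehat{k_{12}}||\widehat{k_{23}}||\widehat{k_{13}}|}.$$ 6. There are $w\in\mathbb C$, $s>0$ and $t\ge0$ such that, with $\Phi(x_1)=(0,0)$, $\Phi(x_2)=(s,0)$, $\Phi(x_3)=(w,t)$, the points $\Phi(x_i)$ are in $\mathbb B^2$ and $H\sim DA_2(\Phi(X))$. Furthermore, the parameters $\delta_{12},\delta_{13},\delta_{23},A_{123}$ are invariant under rescaling, and they uniquely determine the rescaling class of $H$, the points $\Phi(x_i)$ of (6), and the congruence class of the triangle realizing $H$. That is, let $H$ and $H'$ be three-dimensional RKHS, with points labelled by $1,2,3$. Then $H\sim H'$ if and only if the four parameters of $H$ and of $H'$ agree. If they agree, then (a) whenever $\Phi$ and $\Phi'$ are as in (6) for $H$ and $H'$ respectively, $\Phi(x_i)=\Phi'(x'_i)$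 for $i=1,2,3$; and (b) for every $n$, whenever $\Phi,\Phi'$ are injective maps into $\mathbb B^n$ with $H\sim DA_n(\Phi(X))$ and $H'\sim DA_n(\Phi'(X'))$, the ordered triples $(\Phi(x_i))_i$ and $(\Phi'(x_i'))_i$ are congruent. -/

import Mathlib

open scoped ComplexConjugate

noncomputable section

namespace FinRKHS

section Kernel

variable {X : Type*} (H : Type*) [NormedAddCommGroup H] [InnerProductSpace ℂ H]
  [CompleteSpace H] [RKHS ℂ H X ℂ]

/-- The reproducing kernel `k_x`, a vector of `H` (also a function on `X`). -/
def kvec (x : X) : H := RKHS.kerFun H x (1 : ℂ)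

/-- Reproducing property: the value `h(x)` is the inner product of `h` and `k_x`
(in Mathlib the inner product is conjugate linear in its first argument). -/
theorem inner_kvec (h : H) (x : X) : inner ℂ (kvec H x) h = h x := by
  rw [kvec, RKHS.kerFun_inner]
  simp

/-- The Gram matrix entry `k_{xy} = ⟨k_x, k_y⟩ = k_x(y)`. The form `⟨·, ·⟩` of the text is
linear in its first argument, so the arguments appear in the opposite order here. -/
def k (x y : X) : ℂ := inner ℂ (kvec H y) (kvec H x)

theorem k_eq_eval (x y : X) : k H x y = (kvec H x) y := inner_kvec H _ y

/-- The normalized kernel `k̂_x = k_x / ‖k_x‖`. -/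
def kvecHat (x : X) : H := ((‖kvec H x‖ : ℂ)⁻¹) • kvec H x

/-- `k̂_{xy} = ⟨k̂_x, k̂_y⟩`. -/
def kHat (x y : X) : ℂ := inner ℂ (kvecHat H y) (kvecHat H x)

/-- The standing conventions on a finite dimensional RKHS: the reproducing kernels are a basis of
`H`, and no two of them are orthogonal. -/
structure IsIrreducible : Prop where
  linearIndependent : LinearIndependent ℂ (kvec H)
  span_eq_top : Submodule.span ℂ (Set.range (kvec H)) = ⊤
  k_ne_zero : ∀ x y : X, k H x y ≠ 0

/-- The metric `δ_H(x, y)`, with `δ_H(x, y)² = 1 - |k̂_{xy}|²`. -/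
def deltaH (x y : X) : ℝ := √(1 - ‖kHat H x y‖ ^ 2)

/-- The angular invariant `A(x, y, z) = arg (k_{xy} k_{yz} k_{zx})`. -/
def angular (x y z : X) : ℝ := Complex.arg (k H x y * k H y z * k H z x)

/-- The invariant `LF²(x, y, z)` (with `x, y, z` in the roles of the points 1, 2, 3). -/
def LFsq (x y z : X) : ℝ :=
  1 / deltaH H x y ^ 2 * ‖1 - (k H y x * k H x z) / (k H y z * k H x x)‖ ^ 2

/-- `T` is the multiplier operator on `H` with symbol `m`. -/
def IsMultiplier (m : X → ℂ) (T : H →L[ℂ] H) : Prop :=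
  ∀ (h : H) (x : X), (T h) x = m x * h x

/-- The Gleason metric `δ_G(x, y)` of the multiplier algebra. -/
def deltaG (x y : X) : ℝ :=
  sSup {r : ℝ | ∃ (m : X → ℂ) (T : H →L[ℂ] H),
    IsMultiplier H m T ∧ m y = 0 ∧ ‖T‖ ≤ 1 ∧ r = (m x).re}

/-- `T` is the multiplier operator with matrix-valued symbol `m`, from `H ⊗ ℂ^q` (realized as the
Hilbert space of `q`-tuples from `H`) to `H ⊗ ℂ^p`. -/
def IsMatrixMultiplier {p q : ℕ} (m : X → Matrix (Fin p) (Fin q) ℂ)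
    (T : PiLp 2 (fun _ : Fin q => H) →L[ℂ] PiLp 2 (fun _ : Fin p => H)) : Prop :=
  ∀ (h : PiLp 2 (fun _ : Fin q => H)) (i : Fin p) (x : X),
    (T h i : H) x = ∑ j, m x i j * (h j : H) x

/-- The subspace `H_Y` of `H` spanned by the kernels `k_y`, `y ∈ Y`. -/
def kerSpan (Y : Set X) : Submodule ℂ H := Submodule.span ℂ (kvec H '' Y)

instance finiteDimensional_kerSpan (Y : Set X) [Finite Y] : FiniteDimensional ℂ (kerSpan H Y) :=
  FiniteDimensional.span_of_finite ℂ (Set.Finite.image _ (Set.toFinite Y))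

instance completeSpace_kerSpan (Y : Set X) [Finite Y] : CompleteSpace (kerSpan H Y) :=
  FiniteDimensional.complete ℂ _

/-- `H_Y` is a RKHS of functions on `Y`: its vectors are restricted to `Y`. -/
instance rkhsKerSpan (Y : Set X) : RKHS ℂ (kerSpan H Y) Y ℂ where
  coeCLM := ContinuousLinearMap.pi fun y : Y =>
    ((innerSL ℂ (kvec H (y : X))).comp (kerSpan H Y).subtypeL)
  coeCLM_injective := by
    refine (injective_iff_map_eq_zero _).mpr fun f hf => ?_
    have h1 : ∀ y ∈ Y, inner ℂ (kvec H y) (f : H) = 0 := fun y hy => by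
      have := congrFun hf ⟨y, hy⟩
      simpa using this
    have h2 : ∀ g ∈ kerSpan H Y, inner ℂ g (f : H) = 0 := by
      intro g hg
      induction hg using Submodule.span_induction with
      | mem g hg => obtain ⟨y, hy, rfl⟩ := hg; exact h1 y hy
      | zero => simp
      | add a b _ _ ha hb => rw [inner_add_left, ha, hb, add_zero]
      | smul c a _ ha => rw [inner_smul_left, ha, mul_zero]
    exact Subtype.ext (inner_self_eq_zero.mp (h2 _ f.2))

theorem kerSpan_apply (Y : Set X) (f : kerSpan H Y) (y : Y) : f y = (f : H) (y : X) := by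
  exact inner_kvec H (f : H) (y : X)

/-- The (scalar) Pick property: every multiplier of norm one on a space `H_Y` extends to a
multiplier of norm one on `H`. -/
def HasPick [Finite X] : Prop :=
  ∀ (Y : Set X) (n : Y → ℂ) (N : kerSpan H Y →L[ℂ] kerSpan H Y),
    IsMultiplier (kerSpan H Y) n N → ‖N‖ = 1 →
    ∃ (m : X → ℂ) (M : H →L[ℂ] H),
      IsMultiplier H m M ∧ ‖M‖ = 1 ∧ ∀ y : Y, m y = n y

/-- The complete Pick property: the same extension property for matrix-valued multipliers of every
size. -/
def HasCompletePick [Finite X] : Prop :=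
  ∀ (p q : ℕ) (Y : Set X) (n : Y → Matrix (Fin p) (Fin q) ℂ)
    (N : PiLp 2 (fun _ : Fin q => kerSpan H Y) →L[ℂ] PiLp 2 (fun _ : Fin p => kerSpan H Y)),
    IsMatrixMultiplier (kerSpan H Y) n N → ‖N‖ = 1 →
    ∃ (m : X → Matrix (Fin p) (Fin q) ℂ)
      (M : PiLp 2 (fun _ : Fin q => H) →L[ℂ] PiLp 2 (fun _ : Fin p => H)),
      IsMatrixMultiplier H m M ∧ ‖M‖ = 1 ∧ ∀ y : Y, m y = n y

/-- `H'` is a rescaling of `H` by means of the identification `e` of the underlying sets. -/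
def IsRescaling {X' : Type*} (H' : Type*) [NormedAddCommGroup H'] [InnerProductSpace ℂ H']
    [CompleteSpace H'] [RKHS ℂ H' X' ℂ] (e : X ≃ X') : Prop :=
  ∃ γ : X → ℂ, (∀ x, γ x ≠ 0) ∧
    ∀ x y, k H' (e x) (e y) = γ x * conj (γ y) * k H x y

end Kernel

section DruryArveson

/-- The open unit ball of `ℂⁿ`. -/
abbrev Ball (n : ℕ) : Type := Metric.ball (0 : EuclideanSpace ℂ (Fin n)) 1

/-- The Drury-Arveson kernel. The entry at `(z, w)` is (multiplication by)
`k_w(z) = 1 / (1 - ∑ zᵢ conj wᵢ)`. -/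
def daKernel (n : ℕ) : Matrix (Ball n) (Ball n) (ℂ →L[ℂ] ℂ) :=
  Matrix.of fun z w =>
    (1 - inner ℂ (w : EuclideanSpace ℂ (Fin n)) (z : EuclideanSpace ℂ (Fin n)))⁻¹ •
      ContinuousLinearMap.id ℂ ℂ

theorem norm_inner_ball_lt {n : ℕ} (z w : Ball n) :
    ‖inner ℂ (w : EuclideanSpace ℂ (Fin n)) (z : EuclideanSpace ℂ (Fin n))‖ < 1 := by
  have hz : ‖(z : EuclideanSpace ℂ (Fin n))‖ < 1 := mem_ball_zero_iff.mp z.2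
  have hw : ‖(w : EuclideanSpace ℂ (Fin n))‖ < 1 := mem_ball_zero_iff.mp w.2
  refine (norm_inner_le_norm _ _).trans_lt ?_
  nlinarith [norm_nonneg (z : EuclideanSpace ℂ (Fin n)),
    norm_nonneg (w : EuclideanSpace ℂ (Fin n))]

theorem inner_pow_sum_nonneg {n : ℕ} (d : ℕ) (s : Finset (Ball n)) (c : Ball n → ℂ) :
    0 ≤ (∑ w ∈ s, ∑ z ∈ s, c w * conj (c z) *
      inner ℂ (z : EuclideanSpace ℂ (Fin n)) (w : EuclideanSpace ℂ (Fin n)) ^ d).re := by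
  have h : (∑ w ∈ s, ∑ z ∈ s, c w * conj (c z) *
      inner ℂ (z : EuclideanSpace ℂ (Fin n)) (w : EuclideanSpace ℂ (Fin n)) ^ d)
      = ∑ f : Fin d → Fin n, (∑ w ∈ s, c w * ∏ i, w.1 (f i)) *
          conj (∑ z ∈ s, c z * ∏ i, z.1 (f i)) := by
    simp only [map_sum, map_mul, map_prod, Finset.sum_mul_sum]
    rw [Finset.sum_comm' (s := Finset.univ) (t := fun _ => s) (s' := fun _ => Finset.univ)
      (t' := s) (by simp)]
    refine Finset.sum_congr rfl fun w _ => ?_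
    rw [Finset.sum_comm' (s := Finset.univ) (t := fun _ => s) (s' := fun _ => Finset.univ)
      (t' := s) (by simp)]
    refine Finset.sum_congr rfl fun z _ => ?_
    rw [PiLp.inner_apply, Fintype.sum_pow, Finset.mul_sum]
    refine Finset.sum_congr rfl fun f _ => ?_
    simp only [RCLike.inner_apply, Finset.prod_mul_distrib]
    ring
  rw [h, Complex.re_sum]
  refine Finset.sum_nonneg fun f _ => ?_
  rw [Complex.mul_conj]
  simpa using Complex.normSq_nonneg _

theorem daKernel_posSemidef (n : ℕ) : (daKernel n).PosSemidef := by
  have key := (RKHS.posSemidef_tfae (K := daKernel n)).out 0 2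
  refine key.mpr ⟨?_, fun c => ?_⟩
  · ext z w
    simp [daKernel, Matrix.conjTranspose_apply, ContinuousLinearMap.star_eq_adjoint,
      ContinuousLinearMap.adjoint_id]
  · have hs : HasSum (fun d : ℕ => ∑ w ∈ c.support, ∑ z ∈ c.support, conj (c w) * conj (conj (c z)) *
        inner ℂ (z : EuclideanSpace ℂ (Fin n)) (w : EuclideanSpace ℂ (Fin n)) ^ d)
        (∑ w ∈ c.support, ∑ z ∈ c.support, conj (c w) * conj (conj (c z)) *
          (1 - inner ℂ (z : EuclideanSpace ℂ (Fin n)) (w : EuclideanSpace ℂ (Fin n)))⁻¹) :=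
      hasSum_sum fun w _ => hasSum_sum fun z _ =>
        (hasSum_geometric_of_norm_lt_one (norm_inner_ball_lt w z)).mul_left _
    have h0 := HasSum.nonneg (fun d => inner_pow_sum_nonneg d c.support fun z => conj (c z))
      (Complex.hasSum_re hs)
    refine h0.trans_eq ?_
    simp only [Finsupp.sum, daKernel, RCLike.re_to_complex]
    refine congrArg Complex.re (Finset.sum_congr rfl fun w _ => Finset.sum_congr rfl fun z _ => ?_)
    simp
    ring

instance fact_daKernel_posSemidef (n : ℕ) : Fact (daKernel n).PosSemidef := ⟨daKernel_posSemidef n⟩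

/-- The Drury-Arveson space `DA_n`, the RKHS on the ball defined by the Drury-Arveson kernel. -/
abbrev DA (n : ℕ) : Type := RKHS.OfKernel (daKernel n)

theorem kDA (n : ℕ) (z w : Ball n) :
    k (DA n) z w =
      (1 - inner ℂ (z : EuclideanSpace ℂ (Fin n)) (w : EuclideanSpace ℂ (Fin n)))⁻¹ := by
  rw [k_eq_eval, kvec, RKHS.kerFun_apply, RKHS.OfKernel.kernel_ofKernel]
  simp [daKernel]

/-- `H ∼ DA_n(Φ(X))`, the rescaling being the one that matches `a ∈ X` with the point `Φ a` of
the ball (in particular `Φ` is one to one). Here `DA_n(Y)` is the span in `DA_n` of the kernels of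
the points of `Y`, as a RKHS on `Y`. -/
def IsRealization {X : Type*} [Finite X] (H : Type*) [NormedAddCommGroup H]
    [InnerProductSpace ℂ H] [CompleteSpace H] [RKHS ℂ H X ℂ] {n : ℕ} (Φ : X → Ball n) : Prop :=
  ∃ e : X ≃ Set.range Φ, (∀ a, (e a : Ball n) = Φ a) ∧
    IsRescaling H (kerSpan (DA n) (Set.range Φ)) e

/-- The points `Φ(x₁), Φ(x₂), Φ(x₃)` of the ball of `ℂ²` are `(0,0), (s,0), (w,t)` with `s > 0` and
`t ≥ 0`. -/
def IsNormalTriple {X : Type*} (x : Fin 3 ≃ X) (Φ : X → Ball 2) (s : ℝ) (w : ℂ) (t : ℝ) : Prop :=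
  0 < s ∧ 0 ≤ t ∧
    (Φ (x 0) : EuclideanSpace ℂ (Fin 2)) = !₂[0, 0] ∧
    (Φ (x 1) : EuclideanSpace ℂ (Fin 2)) = !₂[(s : ℂ), 0] ∧
    (Φ (x 2) : EuclideanSpace ℂ (Fin 2)) = !₂[w, (t : ℂ)]

/-- Holomorphic self-maps of the ball. -/
def IsHolomorphic {n : ℕ} (f : Ball n → Ball n) : Prop :=
  ∃ F : EuclideanSpace ℂ (Fin n) → EuclideanSpace ℂ (Fin n),
    DifferentiableOn ℂ F (Metric.ball 0 1) ∧ ∀ z : Ball n, F z = f z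

/-- Congruence of two (ordered) systems of points of the ball: some holomorphic automorphism of the
ball takes the one to the other. -/
def BallCongruent {ι : Type*} {n : ℕ} (p q : ι → Ball n) : Prop :=
  ∃ φ : Ball n ≃ Ball n, IsHolomorphic φ ∧ IsHolomorphic φ.symm ∧ ∀ i, φ (p i) = q i

end DruryArveson

section Three

variable {X : Type*} (H : Type*) [NormedAddCommGroup H] [InnerProductSpace ℂ H]
  [CompleteSpace H] [RKHS ℂ H X ℂ]

/-- The parameters `(δ₁₂, δ₁₃, δ₂₃, A₁₂₃)`. -/
def invariants (x : Fin 3 ≃ X) : ℝ × ℝ × ℝ × ℝ :=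
  (deltaH H (x 0) (x 1), deltaH H (x 0) (x 2), deltaH H (x 1) (x 2),
    angular H (x 0) (x 1) (x 2))

end Three

end FinRKHS

end

/-! Normalize the kernel at a point a. The reciprocal of the normalized kernel is `ratio H a b c`,
and everything depends on the Hermitian matrix 1 - ratio. Its row and column at a vanish, so for
three points only a 2 × 2 block remains, with diagonal δ_ab², δ_ac². This block is positive
semidefinite exactly when its determinant is nonnegative, which is `GramIneq`. Clearing denominators
turns this into `SymmIneq`, which is symmetric in the three points, so the choice of a does not
matter. Conditions 4 and 5 are these two inequalities.

If the inequality holds, the matrix is the Gram matrix of 0, (s,0), (w,t) in ℂ²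
(`exists_normalizedAt`). These vectors lie in the ball and realize H in the Drury-Arveson space.
Conversely, a realization with a sent to 0 has Gram matrix 1 - ratio, and Cauchy-Schwarz gives
`GramIneq`.

The same vectors, taken with each point of X as base in turn, give the complete Pick property: a
lurking isometry extends a matrix multiplier to one more point without increasing its norm
(`exists_one_point_extension`). The Pick property follows with 1 × 1 matrices, and extending the
extremal multiplier of a two point space gives δ_H = δ_G.

To return from δ_H(x,y) = δ_G(x,y), compactness gives an extremal multiplier m. Its adjoint attains
its norm at the part of k_x orthogonal to k_y. A contraction preserves inner products with such a
vector, which determines m(z) at the third point, and |m(z)| ≤ δ_H(z,y) is then `GramIneq`.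

For uniqueness, the four parameters determine all the ratios at x₁, and these determine the kernel
up to rescaling. A ball automorphism moving Φ(x₁) to 0 makes 1 - ratio the Gram matrix of the
triple, and equal Gram matrices differ by a unitary. -/

noncomputable section

namespace FinRKHS

/-! ### Contractions, defect operators and elementary tensors. -/

section Hilbert

variable {A E F : Type*} [AddCommGroup A] [Module ℂ A] [FiniteDimensional ℂ A]
  [NormedAddCommGroup E] [InnerProductSpace ℂ E] [NormedAddCommGroup F] [InnerProductSpace ℂ F]

/-- Douglas' factorization lemma for maps from a finite dimensional space. -/
theorem exists_contraction_factor (u : A →ₗ[ℂ] E) (g : A →ₗ[ℂ] F) (h : ∀ x, ‖g x‖ ≤ ‖u x‖) :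
    ∃ V : E →L[ℂ] F, ‖V‖ ≤ 1 ∧ ∀ x, V (u x) = g x := by
  obtain ⟨r, hr⟩ := LinearMap.exists_rightInverse_of_surjective u.rangeRestrict
    (LinearMap.range_eq_top.mpr u.surjective_rangeRestrict)
  have hr' : ∀ y : LinearMap.range u, u (r y) = y := fun y => by
    simpa using congrArg Subtype.val (LinearMap.congr_fun hr y)
  let w : LinearMap.range u →L[ℂ] F := (g ∘ₗ r).mkContinuous 1 fun y => by
    simpa [hr'] using h (r y)
  refine ⟨w ∘L (LinearMap.range u).orthogonalProjectionOnto, ?_, fun x => ?_⟩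
  · refine (ContinuousLinearMap.opNorm_comp_le _ _).trans ?_
    exact mul_le_one₀ (LinearMap.mkContinuous_norm_le _ zero_le_one _) (norm_nonneg _)
      (Submodule.orthogonalProjectionOnto_norm_le _)
  · have h1 : (LinearMap.range u).orthogonalProjectionOnto (u x) = ⟨u x, x, rfl⟩ :=
      Submodule.orthogonalProjectionOnto_mem_subspace_eq_self (⟨u x, x, rfl⟩ : LinearMap.range u)
    -- The vector lies in the kernel of u, and the norm bound forces that kernel into the kernel of
    -- g.
    have h2 : g (r ⟨u x, x, rfl⟩ - x) = 0 := by
      have := h (r ⟨u x, x, rfl⟩ - x)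
      rw [map_sub u, hr', sub_self, norm_zero] at this
      exact norm_le_zero_iff.mp this
    rw [ContinuousLinearMap.comp_apply, h1]
    simpa [w, sub_eq_zero] using h2

/-- The defect operator of a contraction. -/
theorem exists_defect [CompleteSpace E] [CompleteSpace F] (V : E →L[ℂ] F) (hV : ‖V‖ ≤ 1) :
    ∃ D : E →L[ℂ] E, ∀ x y, inner ℂ (D x) (D y) = inner ℂ x y - inner ℂ (V x) (V y) := by
  have hpos : 0 ≤ (1 - V.adjoint ∘L V : E →L[ℂ] E) := by
    rw [ContinuousLinearMap.nonneg_iff_isPositive, ContinuousLinearMap.isPositive_iff_complex]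
    intro x
    have h1 : inner ℂ ((1 - V.adjoint ∘L V : E →L[ℂ] E) x) x
        = ((‖x‖ ^ 2 - ‖V x‖ ^ 2 : ℝ) : ℂ) := by
      simp [ContinuousLinearMap.adjoint_inner_left, inner_self_eq_norm_sq_to_K]
    have h2 : ‖V x‖ ≤ ‖x‖ := by simpa using V.le_of_opNorm_le hV x
    rw [h1]
    refine ⟨rfl, ?_⟩
    have := norm_nonneg (V x)
    simp only [RCLike.re_to_complex, Complex.ofReal_re]
    nlinarith
  obtain ⟨D, hD⟩ := CStarAlgebra.nonneg_iff_eq_star_mul_self.mp hpos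
  refine ⟨D, fun x y => ?_⟩
  have : inner ℂ (D x) (D y) = inner ℂ x ((star D * D) y) := by
    rw [ContinuousLinearMap.star_eq_adjoint, mul_apply_eq_comp,
      ContinuousLinearMap.adjoint_inner_right]
  rw [this, ← hD]
  simp [ContinuousLinearMap.adjoint_inner_right]

theorem inner_sum_self {ι : Type*} (s : Finset ι) (f : ι → E) :
    ((‖∑ b ∈ s, f b‖ ^ 2 : ℝ) : ℂ) = ∑ b ∈ s, ∑ c ∈ s, inner ℂ (f b) (f c) := by
  push_cast
  rw [← RCLike.ofReal_eq_complex_ofReal, ← inner_self_eq_norm_sq_to_K (𝕜 := ℂ), sum_inner]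
  simp only [inner_sum]

theorem norm_sum_eq_of_inner {ι : Type*} (s : Finset ι) (f : ι → E) (g : ι → F)
    (h : ∀ b ∈ s, ∀ c ∈ s, inner ℂ (f b) (f c) = inner ℂ (g b) (g c)) :
    ‖∑ b ∈ s, f b‖ = ‖∑ b ∈ s, g b‖ := by
  have : ((‖∑ b ∈ s, f b‖ ^ 2 : ℝ) : ℂ) = ((‖∑ b ∈ s, g b‖ ^ 2 : ℝ) : ℂ) := by
    rw [inner_sum_self, inner_sum_self]
    exact Finset.sum_congr rfl fun b hb => Finset.sum_congr rfl fun c hc => h b hb c hc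
  exact (pow_left_inj₀ (norm_nonneg _) (norm_nonneg _) two_ne_zero).mp (Complex.ofReal_injective this)

/-- The Gram matrix of f minus that of g is a sum of two Gram matrices, hence positive. -/
theorem norm_sum_le_of_inner {ι G K : Type*} [NormedAddCommGroup G] [InnerProductSpace ℂ G]
    [NormedAddCommGroup K] [InnerProductSpace ℂ K] (s : Finset ι)
    (f : ι → E) (g : ι → F) (d : ι → G) (e : ι → K)
    (h : ∀ b ∈ s, ∀ c ∈ s, inner ℂ (f b) (f c) =
      inner ℂ (g b) (g c) + inner ℂ (d b) (d c) + inner ℂ (e b) (e c)) :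
    ‖∑ b ∈ s, g b‖ ≤ ‖∑ b ∈ s, f b‖ := by
  have h1 : ((‖∑ b ∈ s, f b‖ ^ 2 : ℝ) : ℂ) =
      ((‖∑ b ∈ s, g b‖ ^ 2 + ‖∑ b ∈ s, d b‖ ^ 2 + ‖∑ b ∈ s, e b‖ ^ 2 : ℝ) : ℂ) := by
    rw [Complex.ofReal_add, Complex.ofReal_add]
    simp only [inner_sum_self, ← Finset.sum_add_distrib]
    exact Finset.sum_congr rfl fun b hb => Finset.sum_congr rfl fun c hc => h b hb c hc
  have h2 := Complex.ofReal_injective h1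
  refine le_of_sq_le_sq ?_ (norm_nonneg _)
  rw [h2]
  nlinarith [sq_nonneg ‖∑ b ∈ s, d b‖, sq_nonneg ‖∑ b ∈ s, e b‖]

/-- The elementary tensor `z ⊗ h` in the space of tuples from `E`. -/
def tens {ι : Type*} (z : EuclideanSpace ℂ ι) (h : E) : PiLp 2 (fun _ : ι => E) :=
  WithLp.toLp 2 fun i => z i • h

@[simp] theorem tens_apply {ι : Type*} (z : EuclideanSpace ℂ ι) (h : E) (i : ι) :
    tens z h i = z i • h := rfl

theorem inner_tens {ι : Type*} [Fintype ι] (z z' : EuclideanSpace ℂ ι) (h h' : E) :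
    inner ℂ (tens z h) (tens z' h') = inner ℂ h h' * inner ℂ z z' := by
  simp only [PiLp.inner_apply, tens_apply, inner_smul_left, inner_smul_right, Finset.mul_sum,
    RCLike.inner_apply]
  exact Finset.sum_congr rfl fun i _ => by ring

/-- `h ↦ z ⊗ h`. -/
def tensRight {ι : Type*} (z : EuclideanSpace ℂ ι) : E →ₗ[ℂ] PiLp 2 (fun _ : ι => E) where
  toFun := tens z
  map_add' h h' := by ext i; simp
  map_smul' c h := by ext i; simpa using smul_comm (z i) c h

/-- `z ↦ z ⊗ h`. -/
def tensLeft {ι : Type*} (h : E) : EuclideanSpace ℂ ι →ₗ[ℂ] PiLp 2 (fun _ : ι => E) where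
  toFun z := tens z h
  map_add' z z' := by ext i; simp [add_smul]
  map_smul' c z := by ext i; simp [mul_smul]

@[simp] theorem tensRight_apply {ι : Type*} (z : EuclideanSpace ℂ ι) (h : E) :
    tensRight z h = tens z h := rfl

@[simp] theorem tensLeft_apply {ι : Type*} (z : EuclideanSpace ℂ ι) (h : E) :
    tensLeft h z = tens z h := rfl

end Hilbert

/-! ### Families of linear maps summed over a finite set. -/

section SumMap

variable {X P : Type*} [AddCommGroup P] [Module ℂ P]

/-- `v ↦ ∑ b ∈ s, f b (v b)` as a linear map. -/
def sumMap {E : Type*} [AddCommGroup E] [Module ℂ E] (s : Finset X) (f : X → P →ₗ[ℂ] E) :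
    (s → P) →ₗ[ℂ] E :=
  ∑ b : s, f b ∘ₗ LinearMap.proj b

theorem sumMap_apply {E : Type*} [AddCommGroup E] [Module ℂ E] (s : Finset X)
    (f : X → P →ₗ[ℂ] E) (v : s → P) : sumMap s f v = ∑ b : s, f b (v b) := by
  simp [sumMap]

theorem sumMap_restrict {E : Type*} [AddCommGroup E] [Module ℂ E] (s : Finset X)
    (f : X → P →ₗ[ℂ] E) (v : X → P) : sumMap s f (fun b => v b) = ∑ b ∈ s, f b (v b) := by
  rw [sumMap_apply]
  exact Finset.sum_coe_sort s fun b => f b (v b)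

theorem sumMap_single [DecidableEq X] {E : Type*} [AddCommGroup E] [Module ℂ E] (s : Finset X)
    (f : X → P →ₗ[ℂ] E) (b : s) (v : P) : sumMap s f (Pi.single b v) = f b v := by
  rw [sumMap_apply, Finset.sum_eq_single b]
  · simp
  · intro c _ hc; simp [Pi.single_eq_of_ne hc]
  · simp

end SumMap

/-! ### The lurking isometry and extension point by point. -/

section Extension

variable {X ι P Q K L : Type*} [DecidableEq X] [Fintype ι]
  [NormedAddCommGroup P] [InnerProductSpace ℂ P] [FiniteDimensional ℂ P]
  [NormedAddCommGroup Q] [InnerProductSpace ℂ Q] [FiniteDimensional ℂ Q]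
  [NormedAddCommGroup K] [InnerProductSpace ℂ K] [CompleteSpace K]
  [NormedAddCommGroup L] [InnerProductSpace ℂ L] [CompleteSpace L]

theorem exists_contraction_of_sum {E F : Type*} [NormedAddCommGroup E] [InnerProductSpace ℂ E]
    [NormedAddCommGroup F] [InnerProductSpace ℂ F]
    (s : Finset X) (f : X → P →ₗ[ℂ] E) (g : X → P →ₗ[ℂ] F)
    (h : ∀ v : X → P, ‖∑ b ∈ s, g b (v b)‖ ≤ ‖∑ b ∈ s, f b (v b)‖) :
    ∃ V : E →L[ℂ] F, ‖V‖ ≤ 1 ∧ ∀ b ∈ s, ∀ v, V (f b v) = g b v := by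
  obtain ⟨V, hV, h1⟩ := exists_contraction_factor (sumMap s f) (sumMap s g) fun v => by
    have := h fun b => if hb : b ∈ s then v ⟨b, hb⟩ else 0
    rw [← sumMap_restrict, ← sumMap_restrict] at this
    simpa using this
  refine ⟨V, hV, fun b hb v => ?_⟩
  have := h1 (Pi.single ⟨b, hb⟩ v)
  rwa [sumMap_single, sumMap_single] at this

/-- One point extension of matrix valued multipliers: a lurking isometry argument. The kernel
`kk` is, up to the factors `c`, of the form `1 / (1 - ⟨ζ b, ζ b'⟩)` with `ζ a = 0`. -/
theorem exists_one_point_extension (κ : X → P →ₗ[ℂ] K) (l : X → Q →ₗ[ℂ] L) (kk : X → X → ℂ)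
    (hκ : ∀ b b' v v', inner ℂ (κ b v) (κ b' v') = kk b b' * inner ℂ v v')
    (hl : ∀ b b' v v', inner ℂ (l b v) (l b' v') = kk b b' * inner ℂ v v')
    (ζ : X → EuclideanSpace ℂ ι) (c : X → ℂ) (hc : ∀ b, c b ≠ 0)
    (hkk : ∀ b b', kk b b' * (1 - inner ℂ (ζ b) (ζ b')) = conj (c b) * c b')
    (s : Finset X) (a : X) (ha : a ∉ s) (hζ : ζ a = 0) (S : X → P →ₗ[ℂ] Q)
    (hS : ∀ v : X → P, ‖∑ b ∈ s, l b (S b (v b))‖ ≤ ‖∑ b ∈ s, κ b (v b)‖) :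
    ∃ S' : X → P →ₗ[ℂ] Q, (∀ b ∈ s, S' b = S b) ∧
      ∀ v : X → P, ‖∑ b ∈ insert a s, l b (S' b (v b))‖ ≤ ‖∑ b ∈ insert a s, κ b (v b)‖ := by
  obtain ⟨R, hR, hR'⟩ := exists_contraction_of_sum s κ (fun b => l b ∘ₗ S b) hS
  obtain ⟨D, hD⟩ := exists_defect R hR
  have hD1 : ∀ b ∈ s, ∀ b' ∈ s, ∀ v v', inner ℂ (D (κ b v)) (D (κ b' v')) =
      kk b b' * (inner ℂ v v' - inner ℂ (S b v) (S b' v')) := by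
    intro b hb b' hb' v v'
    rw [hD, hR' b hb, hR' b' hb', LinearMap.comp_apply, LinearMap.comp_apply, hκ, hl]
    ring
  -- Multiplying `hD1` by 1 - ⟨ζ b, ζ b'⟩ and moving the negative terms across gives equal Gram
  -- matrices for u b v = (c b v, ζ b ⊗ Dκ_b v) and g b v = (c b S_b v, Dκ_b v). The lurking
  -- isometry sends the first to the second. Since ζ a = 0, the vector u a v is (c a v, 0), so its
  -- image can serve to define the value at a.
  let u : X → P →ₗ[ℂ] WithLp 2 (P × PiLp 2 (fun _ : ι => K)) := fun b =>
    (WithLp.linearEquiv 2 ℂ (P × PiLp 2 (fun _ : ι => K))).symm.toLinearMap ∘ₗ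
      ((c b • LinearMap.id).prod (tensRight (ζ b) ∘ₗ D.toLinearMap ∘ₗ κ b))
  let g : X → P →ₗ[ℂ] WithLp 2 (Q × K) := fun b =>
    (WithLp.linearEquiv 2 ℂ (Q × K)).symm.toLinearMap ∘ₗ
      ((c b • S b).prod (D.toLinearMap ∘ₗ κ b))
  have hu : ∀ b b' v v', inner ℂ (u b v) (u b' v') = conj (c b) * c b' * inner ℂ v v' +
      inner ℂ (ζ b) (ζ b') * inner ℂ (D (κ b v)) (D (κ b' v')) := by
    intro b b' v v'
    simp [u, WithLp.prod_inner_apply, inner_tens, inner_smul_left, inner_smul_right]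
    ring
  have hg : ∀ b b' v v', inner ℂ (g b v) (g b' v') =
      conj (c b) * c b' * inner ℂ (S b v) (S b' v') + inner ℂ (D (κ b v)) (D (κ b' v')) := by
    intro b b' v v'
    simp [g, WithLp.prod_inner_apply, inner_smul_left, inner_smul_right]
    ring
  have hug : ∀ b ∈ s, ∀ b' ∈ s, ∀ v v', inner ℂ (g b v) (g b' v') = inner ℂ (u b v) (u b' v') := by
    intro b hb b' hb' v v'
    rw [hu, hg, hD1 b hb b' hb', ← hkk]
    ring
  obtain ⟨V, hV, hV'⟩ := exists_contraction_of_sum s u g fun v =>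
    (norm_sum_eq_of_inner s _ _ fun b hb b' hb' => hug b hb b' hb' _ _).le
  obtain ⟨B, hB⟩ := exists_defect V hV
  have hB0 : ∀ b ∈ s, ∀ v, B (u b v) = 0 := fun b hb v => by
    rw [← inner_self_eq_zero (𝕜 := ℂ), hB, hV' b hb, hug b hb b hb, sub_self]
  -- the value of the extended symbol at `a`, and the new defect vectors
  let S₁ : P →ₗ[ℂ] Q := (c a)⁻¹ • (WithLp.fstL 2 ℂ Q K).toLinearMap ∘ₗ V.toLinearMap ∘ₗ u a
  let S' := Function.update S a S₁
  let T : X → P →ₗ[ℂ] K := fun b => (WithLp.sndL 2 ℂ Q K).toLinearMap ∘ₗ V.toLinearMap ∘ₗ u b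
  have hT : ∀ b ∈ s, ∀ v, T b v = D (κ b v) := fun b hb v => by
    simp [T, hV' b hb, g]
  have hSs : ∀ b ∈ s, S' b = S b := fun b hb =>
    Function.update_of_ne (ne_of_mem_of_not_mem hb ha) _ _
  have hVu : ∀ b ∈ insert a s, ∀ b' ∈ insert a s, ∀ v v', inner ℂ (V (u b v)) (V (u b' v')) =
      conj (c b) * c b' * inner ℂ (S' b v) (S' b' v') + inner ℂ (T b v) (T b' v') := by
    have h1 : ∀ b ∈ insert a s, ∀ v, (V (u b v)).fst = c b • S' b v := by
      intro b hb v
      rcases Finset.mem_insert.mp hb with rfl | hb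
      · simp [S', S₁, hc]
      · rw [hV' b hb, hSs b hb]; simp [g]
    intro b hb b' hb' v v'
    rw [WithLp.prod_inner_apply]
    change inner ℂ (V (u b v)).fst (V (u b' v')).fst + inner ℂ (T b v) (T b' v') = _
    rw [h1 b hb, h1 b' hb', inner_smul_left, inner_smul_right]
    ring
  have hu' : ∀ b ∈ insert a s, ∀ b' ∈ insert a s, ∀ v v', inner ℂ (u b v) (u b' v') =
      conj (c b) * c b' * inner ℂ v v' + inner ℂ (ζ b) (ζ b') * inner ℂ (T b v) (T b' v') := by
    intro b hb b' hb' v v'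
    rw [hu]
    rcases Finset.mem_insert.mp hb with rfl | hb
    · simp [hζ]
    rcases Finset.mem_insert.mp hb' with rfl | hb'
    · simp [hζ]
    rw [hT b hb, hT b' hb']
  -- The defect of V is zero on the old points, so only b = b' = a matters; there kk equals conj (c
  -- b) * c b' because ζ a = 0.
  have hBk : ∀ b ∈ insert a s, ∀ b' ∈ insert a s, ∀ v v',
      kk b b' * inner ℂ (B (u b v)) (B (u b' v')) =
        conj (c b) * c b' * inner ℂ (B (u b v)) (B (u b' v')) := by
    intro b hb b' hb' v v'
    rcases Finset.mem_insert.mp hb with rfl | hb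
    · rw [← hkk, hζ]; simp
    · simp [hB0 b hb]
  refine ⟨S', hSs, fun v => norm_sum_le_of_inner _ _ _ (fun b => T b (v b))
    (fun b => B (u b (v b))) fun b hb b' hb' => ?_⟩
  have e1 := hB (u b (v b)) (u b' (v b'))
  rw [hu' b hb b' hb', hVu b hb b' hb'] at e1
  have e2 := hBk b hb b' hb' (v b) (v b')
  have e3 := hkk b b'
  rw [hκ, hl]
  have hne : conj (c b) * c b' ≠ 0 := mul_ne_zero (by simpa using hc b) (hc b')
  apply mul_left_cancel₀ hne
  linear_combination (-kk b b') * e1 + e2 + inner ℂ (T b (v b)) (T b' (v b')) * e3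

/-- Each new point a is added using the normal form based at a, which is why one is required for
every a. -/
theorem exists_extension (κ : X → P →ₗ[ℂ] K) (l : X → Q →ₗ[ℂ] L) (kk : X → X → ℂ)
    (hκ : ∀ b b' v v', inner ℂ (κ b v) (κ b' v') = kk b b' * inner ℂ v v')
    (hl : ∀ b b' v v', inner ℂ (l b v) (l b' v') = kk b b' * inner ℂ v v')
    (hkk : ∀ a, ∃ (ζ : X → EuclideanSpace ℂ ι) (c : X → ℂ), ζ a = 0 ∧ (∀ b, c b ≠ 0) ∧
      ∀ b b', kk b b' * (1 - inner ℂ (ζ b) (ζ b')) = conj (c b) * c b')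
    (s t : Finset X) (S : X → P →ₗ[ℂ] Q)
    (hS : ∀ v : X → P, ‖∑ b ∈ s, l b (S b (v b))‖ ≤ ‖∑ b ∈ s, κ b (v b)‖) :
    ∃ S' : X → P →ₗ[ℂ] Q, (∀ b ∈ s, S' b = S b) ∧
      ∀ v : X → P, ‖∑ b ∈ t ∪ s, l b (S' b (v b))‖ ≤ ‖∑ b ∈ t ∪ s, κ b (v b)‖ := by
  induction t using Finset.induction_on with
  | empty => exact ⟨S, fun _ _ => rfl, by simpa using hS⟩
  | insert a t _ ih =>
    obtain ⟨S', h1, h2⟩ := ih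
    rw [Finset.insert_union]
    by_cases ha : a ∈ t ∪ s
    · rw [Finset.insert_eq_of_mem ha]
      exact ⟨S', h1, h2⟩
    · obtain ⟨ζ, c, hζ, hc, h⟩ := hkk a
      obtain ⟨S₂, h3, h4⟩ :=
        exists_one_point_extension κ l kk hκ hl ζ c hc h (t ∪ s) a ha hζ S' h2
      exact ⟨S₂, fun b hb => (h3 b (Finset.mem_union_right _ hb)).trans (h1 b hb), h4⟩

end Extension

open Matrix

/-! ### Multipliers through their adjoints, and the complete Pick property. -/

section Multipliers

variable {X : Type*} (H : Type*) [NormedAddCommGroup H] [InnerProductSpace ℂ H]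
  [CompleteSpace H] [RKHS ℂ H X ℂ]

theorem kvec_kerSpan (Y : Set X) [Finite Y] (y : Y) :
    (kvec (kerSpan H Y) y : H) = kvec H (y : X) := by
  have : kvec (kerSpan H Y) y = ⟨kvec H y, Submodule.subset_span ⟨y, y.2, rfl⟩⟩ := by
    refine ext_inner_right ℂ fun f => ?_
    rw [inner_kvec, kerSpan_apply, ← inner_kvec]
    rfl
  rw [this]

theorem k_kerSpan (Y : Set X) [Finite Y] (y z : Y) : k (kerSpan H Y) y z = k H (y : X) z := by
  rw [k, k, Submodule.coe_inner, kvec_kerSpan, kvec_kerSpan]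

theorem inner_tens_kvec {p : ℕ} (v : EuclideanSpace ℂ (Fin p)) (x : X)
    (g : PiLp 2 (fun _ : Fin p => H)) :
    inner ℂ (tens v (kvec H x)) g = ∑ i, conj (v i) * (g i : H) x := by
  simp only [PiLp.inner_apply, tens_apply, inner_smul_left, inner_kvec]

/-- Pairing with v ⊗ k_x evaluates at x, so the symbol can be read off from the adjoint on kernels.
This turns extension of multipliers into extension of contractions given on kernel vectors. -/
theorem isMatrixMultiplier_iff {p q : ℕ} (m : X → Matrix (Fin p) (Fin q) ℂ)
    (T : PiLp 2 (fun _ : Fin q => H) →L[ℂ] PiLp 2 (fun _ : Fin p => H)) :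
    IsMatrixMultiplier H m T ↔ ∀ x v, T.adjoint (tens v (kvec H x)) =
      tens (((m x)ᴴ).toEuclideanLin v) (kvec H x) := by
  have key : ∀ (x : X) (v : EuclideanSpace ℂ (Fin p)) (h : PiLp 2 (fun _ : Fin q => H)),
      inner ℂ (tens (((m x)ᴴ).toEuclideanLin v) (kvec H x)) h
        = ∑ i, conj (v i) * ∑ j, m x i j * (h j : H) x := by
    intro x v h
    rw [inner_tens_kvec]
    simp only [toLpLin_apply, mulVec, dotProduct, map_sum, map_mul, conjTranspose_apply,
      Finset.sum_mul, Finset.mul_sum]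
    rw [Finset.sum_comm]
    refine Finset.sum_congr rfl fun i _ => Finset.sum_congr rfl fun j _ => ?_
    simp
    ring
  constructor
  · intro hT x v
    refine ext_inner_right ℂ fun h => ?_
    rw [ContinuousLinearMap.adjoint_inner_left, inner_tens_kvec, key]
    exact Finset.sum_congr rfl fun i _ => by rw [hT]
  · intro hT h i x
    have h1 := congrArg (fun f => inner ℂ f h) (hT x (EuclideanSpace.single i 1))
    simp only [ContinuousLinearMap.adjoint_inner_left, inner_tens_kvec, key] at h1
    simpa [Finset.sum_ite_eq', ite_mul] using h1

/-- N is the compression of M: apply M to tuples from H_Y and project each component back to H_Y. -/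
theorem norm_le_of_restriction [Finite X] {p q : ℕ} (Y : Set X)
    (m : X → Matrix (Fin p) (Fin q) ℂ) (n : Y → Matrix (Fin p) (Fin q) ℂ)
    (M : PiLp 2 (fun _ : Fin q => H) →L[ℂ] PiLp 2 (fun _ : Fin p => H))
    (N : PiLp 2 (fun _ : Fin q => kerSpan H Y) →L[ℂ] PiLp 2 (fun _ : Fin p => kerSpan H Y))
    (hM : IsMatrixMultiplier H m M) (hN : IsMatrixMultiplier (kerSpan H Y) n N)
    (hmn : ∀ y : Y, m y = n y) : ‖N‖ ≤ ‖M‖ := by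
  refine N.opNorm_le_bound (norm_nonneg M) fun h => ?_
  let h' : PiLp 2 (fun _ : Fin q => H) := WithLp.toLp 2 fun j => (h j : H)
  have hh' : ‖h'‖ = ‖h‖ := by simp [PiLp.norm_eq_of_L2, h']
  have hproj : ∀ i, N h i = (kerSpan H Y).orthogonalProjectionOnto (M h' i) := by
    intro i
    refine RKHS.ext fun y => ?_
    rw [hN, ← inner_kvec (kerSpan H Y) (Submodule.orthogonalProjectionOnto _ _),
      Submodule.inner_orthogonalProjectionOnto_eq_of_mem_left, kvec_kerSpan, inner_kvec, hM]
    exact Finset.sum_congr rfl fun j _ => by rw [hmn, kerSpan_apply]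
  rw [← hh']
  refine le_trans ?_ (M.le_opNorm h')
  rw [PiLp.norm_eq_of_L2, PiLp.norm_eq_of_L2]
  refine Real.sqrt_le_sqrt (Finset.sum_le_sum fun i _ => ?_)
  rw [hproj]
  gcongr
  exact Submodule.norm_orthogonalProjectionOnto_apply_le _ _

theorem hasCompletePick_of_normal_form [Finite X] {ι : Type*} [Fintype ι]
    (hkk : ∀ a : X, ∃ (ζ : X → EuclideanSpace ℂ ι) (c : X → ℂ), ζ a = 0 ∧ (∀ b, c b ≠ 0) ∧
      ∀ b b', k H b' b * (1 - inner ℂ (ζ b) (ζ b')) = conj (c b) * c b') :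
    HasCompletePick H := by
  classical
  intro p q Y n N hN hN1
  have := Fintype.ofFinite X
  let S : X → EuclideanSpace ℂ (Fin p) →ₗ[ℂ] EuclideanSpace ℂ (Fin q) := fun b =>
    if hb : b ∈ Y then ((n ⟨b, hb⟩)ᴴ).toEuclideanLin else 0
  have hS : ∀ v : X → EuclideanSpace ℂ (Fin p),
      ‖∑ b ∈ Y.toFinset, tensLeft (kvec H b) (S b (v b))‖
        ≤ ‖∑ b ∈ Y.toFinset, tensLeft (kvec H b) (v b)‖ := by
    intro v
    have h1 := N.adjoint.le_of_opNorm_le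
      ((LinearIsometryEquiv.norm_map ContinuousLinearMap.adjoint N).trans hN1).le
      (∑ y : Y, tens (v y) (kvec (kerSpan H Y) y))
    rw [map_sum, one_mul] at h1
    have h2 : ∀ {r : ℕ} (w : Y → EuclideanSpace ℂ (Fin r)),
        ‖∑ y : Y, tens (w y) (kvec (kerSpan H Y) y)‖ = ‖∑ y : Y, tens (w y) (kvec H (y : X))‖ := by
      intro r w
      refine norm_sum_eq_of_inner _ _ _ fun b _ c _ => ?_
      rw [inner_tens, inner_tens, Submodule.coe_inner, kvec_kerSpan, kvec_kerSpan]
    simp only [(isMatrixMultiplier_iff _ _ _).mp hN] at h1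
    rw [h2, h2] at h1
    have h3 : ∀ {r : ℕ} (w : X → EuclideanSpace ℂ (Fin r)),
        ∑ b ∈ Y.toFinset, tensLeft (kvec H b) (w b) = ∑ y : Y, tens (w y) (kvec H (y : X)) := by
      intro r w
      exact Finset.sum_subtype Y.toFinset (fun b => Set.mem_toFinset)
        fun b => tens (w b) (kvec H b)
    rw [h3 (fun b => S b (v b)), h3 v]
    simpa [S] using h1
  obtain ⟨S', h1, h2⟩ := exists_extension (fun b => tensLeft (kvec H b))
    (fun b => tensLeft (kvec H b)) (fun b b' => k H b' b)
    (fun b b' v v' => inner_tens _ _ _ _) (fun b b' v v' => inner_tens _ _ _ _)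
    hkk Y.toFinset Finset.univ S hS
  rw [Finset.union_eq_left.mpr (Finset.subset_univ _)] at h2
  obtain ⟨T, hT, hT'⟩ := exists_contraction_of_sum Finset.univ (fun b : X => tensLeft (kvec H b))
    (fun b => tensLeft (kvec H b) ∘ₗ S' b) h2
  let m : X → Matrix (Fin p) (Fin q) ℂ := fun b => (toEuclideanLin.symm (S' b))ᴴ
  have hM : IsMatrixMultiplier H m T.adjoint := by
    rw [isMatrixMultiplier_iff]
    intro x v
    rw [ContinuousLinearMap.adjoint_adjoint]
    simpa [m] using hT' x (Finset.mem_univ _) v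
  have hmn : ∀ y : Y, m y = n y := by
    intro y
    simp [m, h1 y (by simp), S]
  refine ⟨m, T.adjoint, hM, le_antisymm ?_ ?_, hmn⟩
  · exact (LinearIsometryEquiv.norm_map ContinuousLinearMap.adjoint T).trans_le hT
  · rw [← hN1]
    exact norm_le_of_restriction H Y m n _ N hM hN hmn

/-- `H` as the space of `1`-tuples. -/
def tupleOne (E : Type*) [NormedAddCommGroup E] [InnerProductSpace ℂ E] :
    E ≃ₗᵢ[ℂ] PiLp 2 (fun _ : Fin 1 => E) where
  toFun h := WithLp.toLp 2 fun _ => h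
  invFun g := g 0
  map_add' _ _ := rfl
  map_smul' _ _ := rfl
  left_inv _ := rfl
  right_inv g := by ext i; rw [Subsingleton.elim i 0]
  norm_map' h := by
    rw [PiLp.norm_eq_of_L2]
    simp only [Finset.univ_unique, Finset.sum_singleton]
    exact Real.sqrt_sq (norm_nonneg h)

theorem hasPick_of_hasCompletePick [Finite X] (h : HasCompletePick H) : HasPick H := by
  intro Y n N hN hN1
  let e := tupleOne (kerSpan H Y)
  let e' := tupleOne H
  obtain ⟨m, M, hM, hM1, hmn⟩ := h 1 1 Y (fun y => Matrix.of fun _ _ => n y)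
    ((e : _ →L[ℂ] _) ∘L N ∘L (e.symm : _ →L[ℂ] _))
    (fun h i x => by rw [Fin.sum_univ_one]; exact hN (h 0) x)
    (by
      rw [← hN1]
      exact (e.toLinearIsometry.norm_toContinuousLinearMap_comp).trans
        (ContinuousLinearMap.opNorm_comp_linearIsometryEquiv N e.symm))
  refine ⟨fun x => m x 0 0, (e'.symm : _ →L[ℂ] _) ∘L M ∘L (e' : _ →L[ℂ] _), fun h x => ?_, ?_, ?_⟩
  · have := hM (e' h) 0 x
    rw [Fin.sum_univ_one] at this
    exact this
  · rw [← hM1]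
    exact (e'.symm.toLinearIsometry.norm_toContinuousLinearMap_comp).trans
      (ContinuousLinearMap.opNorm_comp_linearIsometryEquiv M e')
  · intro y
    exact congrFun (congrFun (hmn y) 0) 0

end Multipliers

/-! ### The metrics δ_H and δ_G. -/

section Kernel

variable {X : Type*} (H : Type*) [NormedAddCommGroup H] [InnerProductSpace ℂ H]
  [CompleteSpace H] [RKHS ℂ H X ℂ]

theorem k_self (x : X) : k H x x = ((‖kvec H x‖ ^ 2 : ℝ) : ℂ) := by
  rw [k, inner_self_eq_norm_sq_to_K]
  norm_cast

theorem conj_k (x y : X) : conj (k H x y) = k H y x := inner_conj_symm _ _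

theorem norm_k_comm (x y : X) : ‖k H x y‖ = ‖k H y x‖ := by rw [← conj_k, RCLike.norm_conj]

theorem norm_kHat (x y : X) : ‖kHat H x y‖ = ‖k H x y‖ / (‖kvec H x‖ * ‖kvec H y‖) := by
  rw [kHat, kvecHat, kvecHat, inner_smul_left, inner_smul_right, k]
  simp
  field_simp

theorem norm_kHat_le_one (x y : X) : ‖kHat H x y‖ ≤ 1 := by
  rw [norm_kHat]
  refine div_le_one_of_le₀ ?_ (by positivity)
  rw [k, mul_comm]
  exact norm_inner_le_norm _ _

theorem deltaH_nonneg (x y : X) : 0 ≤ deltaH H x y := Real.sqrt_nonneg _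

theorem deltaH_sq (x y : X) : deltaH H x y ^ 2 = 1 - ‖kHat H x y‖ ^ 2 := by
  rw [deltaH, Real.sq_sqrt]
  have := norm_kHat_le_one H x y
  nlinarith [norm_nonneg (kHat H x y)]

theorem deltaH_sq' (x y : X) :
    deltaH H x y ^ 2 = 1 - ‖k H x y‖ ^ 2 / (‖kvec H x‖ ^ 2 * ‖kvec H y‖ ^ 2) := by
  rw [deltaH_sq, norm_kHat, div_pow, mul_pow]

theorem deltaH_comm (x y : X) : deltaH H x y = deltaH H y x := by
  rw [deltaH, deltaH, norm_kHat, norm_kHat, norm_k_comm, mul_comm]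

/-- The component of `k_x` orthogonal to `k_y`. -/
def residual (x y : X) : H := kvec H x - (k H x y / k H y y) • kvec H y

variable {H}

theorem IsIrreducible.norm_kvec_pos (hH : IsIrreducible H) (x : X) : 0 < ‖kvec H x‖ :=
  norm_pos_iff.mpr (hH.linearIndependent.ne_zero x)

theorem IsIrreducible.deltaH_pos (hH : IsIrreducible H) {x y : X} (hxy : x ≠ y) :
    0 < deltaH H x y := by
  have hx := hH.norm_kvec_pos x
  have hy := hH.norm_kvec_pos y
  rw [deltaH, Real.sqrt_pos, sub_pos, sq_lt_one_iff₀ (norm_nonneg _), norm_kHat,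
    div_lt_one (by positivity)]
  refine lt_of_le_of_ne (by rw [k, mul_comm]; exact norm_inner_le_norm _ _) fun h => ?_
  rw [k, mul_comm] at h
  have hy0 : kvec H y ≠ 0 := hH.linearIndependent.ne_zero y
  have hx0 : kvec H x ≠ 0 := hH.linearIndependent.ne_zero x
  obtain ⟨r, hr, hr'⟩ := (norm_inner_eq_norm_iff hy0 hx0).mp h
  exact (linearIndepOn_pair_iff (K := ℂ) (kvec H) hxy.symm hy0).mp
    (hH.linearIndependent.linearIndepOn _) r hr'.symm

theorem IsIrreducible.deltaH_sq_lt_one (hH : IsIrreducible H) (x y : X) :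
    deltaH H x y ^ 2 < 1 := by
  have hx := hH.norm_kvec_pos x
  have hy := hH.norm_kvec_pos y
  have hk := norm_pos_iff.mpr (hH.k_ne_zero x y)
  rw [deltaH_sq', sub_lt_self_iff]
  positivity

theorem inner_kvec_residual {x y : X} (hy : kvec H y ≠ 0) :
    inner ℂ (kvec H y) (residual H x y) = 0 := by
  have : inner ℂ (kvec H y) (kvec H y) ≠ 0 := inner_self_ne_zero.mpr hy
  rw [residual, inner_sub_right, inner_smul_right, k, k, div_mul_cancel₀ _ this, sub_self]

theorem inner_residual_right {x y : X} (hy : kvec H y ≠ 0) (z : X) :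
    inner ℂ (residual H z y) (residual H x y) = inner ℂ (kvec H z) (residual H x y) := by
  nth_rw 1 [residual]
  rw [inner_sub_left, inner_smul_left, inner_kvec_residual hy, mul_zero, sub_zero]

theorem inner_kvec_residual_right (x y z : X) :
    inner ℂ (kvec H z) (residual H x y) = k H x z - k H x y / k H y y * k H y z := by
  rw [residual, inner_sub_right, inner_smul_right]
  rfl

theorem inner_kvec_residual_self {x y : X} (hx : kvec H x ≠ 0) (hy : kvec H y ≠ 0) :
    inner ℂ (kvec H x) (residual H x y) = ((‖kvec H x‖ ^ 2 * deltaH H x y ^ 2 : ℝ) : ℂ) := by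
  have h1 : (‖kvec H x‖ : ℂ) ≠ 0 := by simpa using hx
  have h2 : (‖kvec H y‖ : ℂ) ≠ 0 := by simpa using hy
  have h3 : k H x y * k H y x = ((‖k H x y‖ ^ 2 : ℝ) : ℂ) := by
    rw [← conj_k H x y, Complex.mul_conj, Complex.normSq_eq_norm_sq]
  rw [inner_kvec_residual_right, deltaH_sq', k_self, k_self, div_mul_eq_mul_div, h3]
  push_cast
  field_simp

theorem norm_residual {x y : X} (hx : kvec H x ≠ 0) (hy : kvec H y ≠ 0) :
    ‖residual H x y‖ = ‖kvec H x‖ * deltaH H x y := by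
  have h : ((‖residual H x y‖ ^ 2 : ℝ) : ℂ) = (((‖kvec H x‖ * deltaH H x y) ^ 2 : ℝ) : ℂ) := by
    rw [mul_pow, ← inner_kvec_residual_self hx hy, ← inner_residual_right hy,
      inner_self_eq_norm_sq_to_K]
    norm_cast
  exact (pow_left_inj₀ (norm_nonneg _) (mul_nonneg (norm_nonneg _) (deltaH_nonneg _ _ _))
    two_ne_zero).mp (Complex.ofReal_injective h)

theorem IsMultiplier.adjoint_kvec {m : X → ℂ} {T : H →L[ℂ] H} (hT : IsMultiplier H m T) (x : X) :
    T.adjoint (kvec H x) = conj (m x) • kvec H x := by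
  refine ext_inner_right ℂ fun h => ?_
  rw [ContinuousLinearMap.adjoint_inner_left, inner_kvec, hT, inner_smul_left, inner_kvec,
    Complex.conj_conj]

theorem IsMultiplier.adjoint_residual {m : X → ℂ} {T : H →L[ℂ] H} (hT : IsMultiplier H m T)
    {y : X} (hy : m y = 0) (x : X) :
    T.adjoint (residual H x y) = conj (m x) • kvec H x := by
  rw [residual, map_sub, map_smul, hT.adjoint_kvec, hT.adjoint_kvec, hy]
  simp

/-- The adjoint kills k_y, so it sends the residual of k_x, of norm ‖k_x‖δ, to conj (m x) k_x. -/
theorem IsMultiplier.norm_le_deltaH (hH : ∀ x, kvec H x ≠ 0) {m : X → ℂ} {T : H →L[ℂ] H}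
    (hT : IsMultiplier H m T) (hT1 : ‖T‖ ≤ 1) {y : X} (hy : m y = 0) (x : X) :
    ‖m x‖ ≤ deltaH H x y := by
  have h1 := T.adjoint.le_of_opNorm_le
    ((LinearIsometryEquiv.norm_map ContinuousLinearMap.adjoint T).trans_le hT1) (residual H x y)
  rw [hT.adjoint_residual hy, norm_smul, RCLike.norm_conj, one_mul, norm_residual (hH x) (hH y),
    mul_comm] at h1
  exact le_of_mul_le_mul_left h1 (norm_pos_iff.mpr (hH x))

theorem deltaG_set_nonempty (x y : X) : {r : ℝ | ∃ (m : X → ℂ) (T : H →L[ℂ] H),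
    IsMultiplier H m T ∧ m y = 0 ∧ ‖T‖ ≤ 1 ∧ r = (m x).re}.Nonempty :=
  ⟨0, 0, 0, fun h x => by simp [RKHS.coe_zero], rfl, by simp, rfl⟩

theorem deltaG_set_le (hH : ∀ x, kvec H x ≠ 0) {x y : X} {r : ℝ} (hr : r ∈ {r : ℝ |
    ∃ (m : X → ℂ) (T : H →L[ℂ] H), IsMultiplier H m T ∧ m y = 0 ∧ ‖T‖ ≤ 1 ∧ r = (m x).re}) :
    r ≤ deltaH H x y := by
  obtain ⟨m, T, hT, hm, hT1, rfl⟩ := hr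
  exact (Complex.re_le_norm _).trans (hT.norm_le_deltaH hH hT1 hm x)

/-- A norm one operator that is, at two points, the extremal multiplier of a two point space. -/
theorem exists_extremal {x y : X} (hx : kvec H x ≠ 0) (hy : kvec H y ≠ 0)
    (hδ : 0 < deltaH H x y) :
    ∃ N : H →L[ℂ] H, ‖N‖ = 1 ∧ ∀ h : H, (N h) x = deltaH H x y * h x ∧ (N h) y = 0 := by
  have hn : 0 < ‖kvec H x‖ := norm_pos_iff.mpr hx
  -- The rank one operator h ↦ h(x) r / (‖k_x‖² δ), where r is the residual: r vanishes at y and has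
  -- value ‖k_x‖² δ² at x.
  refine ⟨(innerSL ℂ (kvec H x)).smulRight
    (((‖kvec H x‖ ^ 2 * deltaH H x y)⁻¹ : ℝ) • residual H x y), ?_, fun h => ⟨?_, ?_⟩⟩
  · rw [ContinuousLinearMap.norm_smulRight_apply, innerSL_apply_norm, norm_smul,
      norm_residual hx hy, Real.norm_of_nonneg (by positivity)]
    field_simp
  · rw [← inner_kvec]
    simp only [ContinuousLinearMap.smulRight_apply, innerSL_apply_apply, inner_smul_right,
      inner_smul_right_eq_smul]
    rw [inner_kvec_residual_self hx hy, inner_kvec]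
    have h1 : (‖kvec H x‖ : ℂ) ≠ 0 := by simpa using hx
    have h2 : (deltaH H x y : ℂ) ≠ 0 := by exact_mod_cast hδ.ne'
    simp only [Complex.real_smul]
    push_cast
    field_simp
  · rw [← inner_kvec]
    simp only [ContinuousLinearMap.smulRight_apply, inner_smul_right,
      inner_smul_right_eq_smul, inner_kvec_residual hy, smul_zero, mul_zero]

theorem deltaH_kerSpan [Finite X] (Y : Set X) (x y : Y) :
    deltaH (kerSpan H Y) x y = deltaH H (x : X) y := by
  have h : ∀ z : Y, ‖kvec (kerSpan H Y) z‖ = ‖kvec H (z : X)‖ := fun z => by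
    rw [← kvec_kerSpan, Submodule.coe_norm]
  rw [deltaH, deltaH, norm_kHat, norm_kHat, k_kerSpan, h, h]

theorem HasPick.deltaH_eq_deltaG [Finite X] (hH : IsIrreducible H) (h : HasPick H) {x y : X}
    (hxy : x ≠ y) : deltaH H x y = deltaG H x y := by
  classical
  have h0 : ∀ x, kvec H x ≠ 0 := fun x => hH.linearIndependent.ne_zero x
  refine le_antisymm ?_ (csSup_le (deltaG_set_nonempty x y) fun r hr => deltaG_set_le h0 hr)
  let Y : Set X := {x, y}
  let x' : Y := ⟨x, by simp [Y]⟩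
  let y' : Y := ⟨y, by simp [Y]⟩
  have h1 : ∀ z : Y, kvec (kerSpan H Y) z ≠ 0 := fun z hz => h0 z (by
    rw [← kvec_kerSpan, hz]; rfl)
  obtain ⟨N, hN, hN'⟩ := exists_extremal (h1 x') (h1 y')
    (by rw [deltaH_kerSpan]; exact hH.deltaH_pos hxy)
  obtain ⟨m, M, hM, hM1, hm⟩ := h Y (fun z => if z = x' then (deltaH H x y : ℂ) else 0) N
    (by
      rintro g ⟨z, hz⟩
      have hz' : z = x ∨ z = y := hz
      rcases hz' with rfl | rfl
      · have := (hN' g).1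
        rw [deltaH_kerSpan] at this
        simpa [x'] using this
      · have : (⟨z, hz⟩ : Y) ≠ x' := fun h => hxy (congrArg Subtype.val h).symm
        exact (hN' g).2.trans (by simp [this])) hN
  refine le_csSup ⟨_, fun r hr => deltaG_set_le h0 hr⟩ ⟨m, M, hM, ?_, hM1.le, ?_⟩
  · have : y' ≠ x' := fun h => hxy (congrArg Subtype.val h).symm
    simpa [this] using hm y'
  · have := hm x'
    rw [if_pos rfl] at this
    rw [this, Complex.ofReal_re]

/-- The supremum is attained by compactness: the symbol ⟨T k_b, k_b⟩ / k_bb is continuous in T, so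
the admissible multipliers form a closed subset of the compact unit ball of operators. -/
theorem exists_eq_deltaG [FiniteDimensional ℂ H] (hH : ∀ x, kvec H x ≠ 0) (x y : X) :
    ∃ (m : X → ℂ) (T : H →L[ℂ] H),
      IsMultiplier H m T ∧ m y = 0 ∧ ‖T‖ ≤ 1 ∧ deltaG H x y = (m x).re := by
  have : ProperSpace (H →L[ℂ] H) := FiniteDimensional.proper ℂ _
  let sym : (H →L[ℂ] H) → X → ℂ := fun T b => inner ℂ (kvec H b) (T (kvec H b)) / k H b b
  have hsym : ∀ b, Continuous fun T => sym T b := fun b => by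
    simp only [sym]
    fun_prop
  let C : Set (H →L[ℂ] H) := Metric.closedBall 0 1 ∩
    ({T | ∀ (h : H) (b : X), inner ℂ (kvec H b) (T h) = sym T b * h b} ∩ {T | sym T y = 0})
  have hC : IsCompact C := by
    refine (isCompact_closedBall 0 1).inter_right (IsClosed.inter ?_ ?_)
    · simp only [Set.ofPred_forall]
      refine isClosed_iInter fun h => isClosed_iInter fun b => isClosed_eq (by fun_prop) ?_
      exact (hsym b).mul continuous_const
    · exact isClosed_eq (hsym y) continuous_const
  have hs : {r : ℝ | ∃ (m : X → ℂ) (T : H →L[ℂ] H), IsMultiplier H m T ∧ m y = 0 ∧ ‖T‖ ≤ 1 ∧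
      r = (m x).re} = (fun T => (sym T x).re) '' C := by
    ext r
    constructor
    · rintro ⟨m, T, hT, hm, hT1, rfl⟩
      have h1 : ∀ b, sym T b = m b := fun b => by
        simp only [sym]
        rw [inner_kvec, hT, ← k_eq_eval, mul_div_assoc, div_self, mul_one]
        exact inner_self_ne_zero.mpr (hH b)
      refine ⟨T, ⟨by simpa using hT1, fun h b => ?_, ?_⟩, ?_⟩
      · rw [h1, inner_kvec, hT]
      · exact (h1 y).trans hm
      · simp only [h1]
    · rintro ⟨T, ⟨hT1, hT, hm⟩, rfl⟩
      exact ⟨sym T, T, fun h b => by rw [← inner_kvec, hT], hm, by simpa using hT1, rfl⟩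
  have h2 := (hs ▸ (hC.image (Complex.continuous_re.comp (hsym x)))).sSup_mem
    (deltaG_set_nonempty x y)
  obtain ⟨m, T, h⟩ := h2
  exact ⟨m, T, h⟩

/-! ### The determinant inequality and its symmetric form. -/

variable (H) in
/-- For a space normalized at `a`, this says that the `2 × 2` matrix of the numbers
`1 - 1 / k_{yz}` has a nonnegative determinant. -/
def GramIneq (a b c : X) : Prop :=
  ‖k H b c * k H a a - k H b a * k H a c‖ ^ 2 ≤
    deltaH H a b ^ 2 * deltaH H a c ^ 2 * (‖k H b c‖ ^ 2 * ‖k H a a‖ ^ 2)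

/-- The defect operator vanishes at a vector whose norm the contraction preserves. -/
theorem inner_eq_of_norm_eq {E F : Type*} [NormedAddCommGroup E] [InnerProductSpace ℂ E]
    [CompleteSpace E] [NormedAddCommGroup F] [InnerProductSpace ℂ F] [CompleteSpace F]
    (T : E →L[ℂ] F) (hT : ‖T‖ ≤ 1) {e : E} (he : ‖T e‖ = ‖e‖) (f : E) :
    inner ℂ (T f) (T e) = inner ℂ f e := by
  obtain ⟨D, hD⟩ := exists_defect T hT
  have h0 : D e = 0 := by
    rw [← inner_self_eq_zero (𝕜 := ℂ), hD, inner_self_eq_norm_sq_to_K,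
      inner_self_eq_norm_sq_to_K, he, sub_self]
  have := hD f e
  rw [h0, inner_zero_right] at this
  exact (sub_eq_zero.mp this.symm).symm

/-- The extremal adjoint preserves the norm of the residual of k_x, hence its inner product with the
residual of k_z. This expresses the determinant entry through m z, whose modulus is at most
δ_H(z,y). -/
theorem gramIneq_of_deltaH_eq_deltaG [FiniteDimensional ℂ H] (hH : IsIrreducible H) {x y : X}
    (h : deltaH H x y = deltaG H x y) (z : X) : GramIneq H y z x := by
  have h0 : ∀ x, kvec H x ≠ 0 := fun x => hH.linearIndependent.ne_zero x
  obtain ⟨m, T, hT, hm, hT1, hG⟩ := exists_eq_deltaG h0 x y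
  have hx := hT.norm_le_deltaH h0 hT1 hm x
  have hz := hT.norm_le_deltaH h0 hT1 hm z
  have hmx : ‖m x‖ = deltaH H x y :=
    le_antisymm hx ((h.trans hG).trans_le (Complex.re_le_norm _))
  have hTa : ‖T.adjoint‖ ≤ 1 := (LinearIsometryEquiv.norm_map ContinuousLinearMap.adjoint T).trans_le hT1
  have h1 := inner_eq_of_norm_eq T.adjoint hTa (e := residual H x y) (by
    rw [hT.adjoint_residual hm, norm_smul, RCLike.norm_conj, norm_residual (h0 x) (h0 y), hmx,
      mul_comm]) (residual H z y)
  rw [hT.adjoint_residual hm, hT.adjoint_residual hm, inner_residual_right (h0 y),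
    inner_kvec_residual_right, inner_smul_left, inner_smul_right, Complex.conj_conj] at h1
  change m z * (conj (m x) * k H x z) = _ at h1
  have hyy : k H y y ≠ 0 := hH.k_ne_zero y y
  have h2 : conj (k H z x * k H y y - k H z y * k H y x) = m z * conj (m x) * k H x z * k H y y := by
    rw [map_sub, map_mul, map_mul, conj_k, conj_k, conj_k, conj_k, mul_assoc (m z), h1]
    field_simp
  rw [GramIneq, ← RCLike.norm_conj, h2, norm_mul, norm_mul, norm_mul, RCLike.norm_conj, hmx,
    norm_k_comm H x z, deltaH_comm H y x, deltaH_comm H y z, mul_pow, mul_pow, mul_pow]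
  have h3 : ‖m z‖ ^ 2 ≤ deltaH H z y ^ 2 := by gcongr
  have h4 : 0 ≤ deltaH H x y ^ 2 * ‖k H z x‖ ^ 2 * ‖k H y y‖ ^ 2 := by positivity
  nlinarith [mul_le_mul_of_nonneg_right h3 h4]

variable (H) in
/-- The symmetric form of `GramIneq`. -/
def SymmIneq (x y z : X) : Prop :=
  ‖kvec H x‖ ^ 2 * ‖kvec H y‖ ^ 2 * ‖k H y z‖ ^ 2 * ‖k H x z‖ ^ 2
    + ‖kvec H y‖ ^ 2 * ‖kvec H z‖ ^ 2 * ‖k H x y‖ ^ 2 * ‖k H x z‖ ^ 2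
    + ‖kvec H x‖ ^ 2 * ‖kvec H z‖ ^ 2 * ‖k H x y‖ ^ 2 * ‖k H y z‖ ^ 2
    - ‖k H x y‖ ^ 2 * ‖k H y z‖ ^ 2 * ‖k H x z‖ ^ 2
  ≤ 2 * (‖kvec H x‖ ^ 2 * ‖kvec H y‖ ^ 2 * ‖kvec H z‖ ^ 2) * (k H x y * k H y z * k H z x).re

theorem SymmIneq.rotate {x y z : X} (h : SymmIneq H x y z) : SymmIneq H y z x := by
  rw [SymmIneq] at *
  rw [norm_k_comm H z x, norm_k_comm H y x,
    show k H y z * k H z x * k H x y = k H x y * k H y z * k H z x by ring]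
  linarith

theorem SymmIneq.swap {x y z : X} (h : SymmIneq H x y z) : SymmIneq H y x z := by
  rw [SymmIneq] at *
  have : (k H y x * k H x z * k H z y).re = (k H x y * k H y z * k H z x).re := by
    rw [← Complex.conj_re, map_mul, map_mul, conj_k, conj_k, conj_k]
    congr 1
    ring
  rw [this, norm_k_comm H y x]
  linarith

theorem SymmIneq.of_fin {x : Fin 3 → X} (h : SymmIneq H (x 0) (x 1) (x 2)) {i j l : Fin 3}
    (hij : i ≠ j) (hil : i ≠ l) (hjl : j ≠ l) : SymmIneq H (x i) (x j) (x l) := by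
  have h1 := h.rotate
  have h2 := h1.rotate
  have h3 := h.swap
  have h4 := h1.swap
  have h5 := h2.swap
  fin_cases i <;> fin_cases j <;> fin_cases l <;> first | assumption | (simp at *)

theorem SymmIneq.to_fin {x : Fin 3 → X} {i j l : Fin 3} (h : SymmIneq H (x i) (x j) (x l))
    (hij : i ≠ j) (hil : i ≠ l) (hjl : j ≠ l) : SymmIneq H (x 0) (x 1) (x 2) := by
  have h1 := h.rotate
  have h2 := h1.rotate
  have h3 := h.swap
  have h4 := h1.swap
  have h5 := h2.swap
  fin_cases i <;> fin_cases j <;> fin_cases l <;> first | assumption | (simp at *)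

/-- After expansion the terms |k_bc|²‖k_a‖⁴ cancel; multiplying by ‖k_b‖²‖k_c‖² leaves an expression
symmetric in a, b, c. -/
theorem gramIneq_iff_symmIneq (hH : IsIrreducible H) (a b c : X) :
    GramIneq H a b c ↔ SymmIneq H a b c := by
  have ha := hH.norm_kvec_pos a
  have hb := hH.norm_kvec_pos b
  have hc := hH.norm_kvec_pos c
  have h1 : ‖k H b c * k H a a - k H b a * k H a c‖ ^ 2 = ‖k H b c‖ ^ 2 * (‖kvec H a‖ ^ 2) ^ 2 +
      ‖k H a b‖ ^ 2 * ‖k H a c‖ ^ 2 -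
        2 * ‖kvec H a‖ ^ 2 * (k H a b * k H b c * k H c a).re := by
    rw [← conj_k H a b, ← conj_k H a c, k_self]
    generalize ‖kvec H a‖ ^ 2 = N
    simp only [← Complex.normSq_eq_norm_sq, Complex.normSq_apply]
    simp
    ring
  have h2 : ‖k H a a‖ = ‖kvec H a‖ ^ 2 := by
    rw [k_self, Complex.norm_real, Real.norm_of_nonneg (by positivity)]
  rw [GramIneq, SymmIneq, h1, h2, deltaH_sq', deltaH_sq']
  have hbc : 0 < ‖kvec H b‖ ^ 2 * ‖kvec H c‖ ^ 2 := by positivity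
  rw [← sub_nonneg, ← mul_nonneg_iff_of_pos_left hbc, ← sub_nonneg (b := _ - _)]
  refine iff_of_eq (congrArg _ ?_)
  field_simp
  ring

theorem LFsq_le_iff (hH : IsIrreducible H) {x y : X} (z : X) (hxy : x ≠ y) :
    LFsq H x y z ≤ deltaH H x z ^ 2 ↔ GramIneq H x y z := by
  have hδ := hH.deltaH_pos hxy
  have h1 := hH.k_ne_zero y z
  have h2 := hH.k_ne_zero x x
  have h3 : 1 - (k H y x * k H x z) / (k H y z * k H x x) =
      (k H y z * k H x x - k H y x * k H x z) / (k H y z * k H x x) := by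
    field_simp
  have h4 : 0 < ‖k H y z‖ ^ 2 * ‖k H x x‖ ^ 2 := by positivity
  rw [LFsq, GramIneq, h3, norm_div, norm_mul, div_pow, mul_pow, one_div_mul_eq_div, div_div,
    div_le_iff₀ (by positivity)]
  refine iff_of_eq (congrArg _ ?_)
  ring

theorem cos_ineq_iff (hH : IsIrreducible H) (x y z : X) :
    1 / ‖kHat H x y‖ ^ 2 + 1 / ‖kHat H y z‖ ^ 2 + 1 / ‖kHat H x z‖ ^ 2 - 1
      ≤ 2 * Real.cos (angular H x y z) / (‖kHat H x y‖ * ‖kHat H y z‖ * ‖kHat H x z‖) ↔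
    SymmIneq H x y z := by
  have hx := hH.norm_kvec_pos x
  have hy := hH.norm_kvec_pos y
  have hz := hH.norm_kvec_pos z
  have hxy := norm_pos_iff.mpr (hH.k_ne_zero x y)
  have hyz := norm_pos_iff.mpr (hH.k_ne_zero y z)
  have hxz := norm_pos_iff.mpr (hH.k_ne_zero x z)
  rw [angular, Complex.cos_arg (mul_ne_zero (mul_ne_zero (hH.k_ne_zero _ _) (hH.k_ne_zero _ _))
    (hH.k_ne_zero _ _)), norm_mul, norm_mul, norm_k_comm H z x, SymmIneq]
  simp only [norm_kHat]
  have hpos : 0 < ‖k H x y‖ ^ 2 * ‖k H y z‖ ^ 2 * ‖k H x z‖ ^ 2 := by positivity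
  rw [← sub_nonneg, ← mul_nonneg_iff_of_pos_left hpos, ← sub_nonneg (b := _ - _)]
  refine iff_of_eq (congrArg _ ?_)
  field_simp

end Kernel

/-! ### Normalized kernels and realizations in the ball. -/

section NormalForm

variable {X : Type*} {H : Type*} [NormedAddCommGroup H] [InnerProductSpace ℂ H]
  [CompleteSpace H] [RKHS ℂ H X ℂ]

theorem k_mul_k_comm (x y : X) : k H x y * k H y x = ((‖k H x y‖ ^ 2 : ℝ) : ℂ) := by
  rw [← conj_k H x y, Complex.mul_conj, Complex.normSq_eq_norm_sq]

theorem norm_k_self (x : X) : ‖k H x x‖ = ‖kvec H x‖ ^ 2 := by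
  rw [k_self, Complex.norm_real, Real.norm_of_nonneg (by positivity)]

variable (H) in
/-- `k_{ba} k_{ac} / (k_{bc} k_{aa})`, the reciprocal of the kernel normalized at `a`. -/
def ratio (a b c : X) : ℂ := (k H b a * k H a c) / (k H b c * k H a a)

theorem conj_ratio (a b c : X) : conj (ratio H a b c) = ratio H a c b := by
  rw [ratio, ratio, map_div₀, map_mul, map_mul, conj_k, conj_k, conj_k, conj_k,
    mul_comm (k H a b)]

theorem IsIrreducible.ratio_left (hH : IsIrreducible H) (a c : X) : ratio H a a c = 1 := by
  rw [ratio, mul_comm]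
  exact div_self (mul_ne_zero (hH.k_ne_zero _ _) (hH.k_ne_zero _ _))

theorem IsIrreducible.ratio_right (hH : IsIrreducible H) (a b : X) : ratio H a b a = 1 := by
  rw [← conj_ratio, hH.ratio_left, map_one]

theorem ratio_self (a b : X) : ratio H a b b = ((1 - deltaH H a b ^ 2 : ℝ) : ℂ) := by
  rw [ratio, k_mul_k_comm, k_self, k_self, deltaH_sq', norm_k_comm H b a]
  push_cast
  rw [sub_sub_cancel, mul_comm (_ ^ 2 : ℂ)]

/-- The phase comes from the angular invariant and the modulus from the metric, so the four
parameters determine the ratio. -/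
theorem IsIrreducible.ratio_eq_angular (hH : IsIrreducible H) (a b c : X) :
    ratio H a b c = conj (Complex.exp (angular H a b c * Complex.I)) *
      ((‖kHat H a b‖ * ‖kHat H a c‖ / ‖kHat H b c‖ : ℝ) : ℂ) := by
  have ha := hH.norm_kvec_pos a
  have hb := hH.norm_kvec_pos b
  have hc := hH.norm_kvec_pos c
  have hab := norm_pos_iff.mpr (hH.k_ne_zero a b)
  have hbc := norm_pos_iff.mpr (hH.k_ne_zero b c)
  have hac := norm_pos_iff.mpr (hH.k_ne_zero a c)
  set T := k H a b * k H b c * k H c a with hT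
  have hTn : ‖T‖ = ‖k H a b‖ * ‖k H b c‖ * ‖k H a c‖ := by
    rw [hT, norm_mul, norm_mul, norm_k_comm H c a]
  have h1 : ratio H a b c = conj T / ((‖k H b c‖ ^ 2 * ‖kvec H a‖ ^ 2 : ℝ) : ℂ) := by
    have := hH.k_ne_zero c b
    have h2 := hH.k_ne_zero b c
    have h3 := hH.k_ne_zero a a
    rw [hT, map_mul, map_mul, conj_k, conj_k, conj_k, ratio, Complex.ofReal_mul, ← k_mul_k_comm,
      ← k_self]
    field_simp
  have h2 : (‖kHat H a b‖ * ‖kHat H a c‖ / ‖kHat H b c‖) =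
      ‖T‖ / (‖k H b c‖ ^ 2 * ‖kvec H a‖ ^ 2) := by
    rw [norm_kHat, norm_kHat, norm_kHat, hTn]
    field_simp
  have h3 : conj T = conj (Complex.exp (angular H a b c * Complex.I)) * (‖T‖ : ℂ) := by
    rw [← Complex.norm_mul_exp_arg_mul_I T, map_mul, Complex.conj_ofReal, angular, ← hT, mul_comm]
    simp
  rw [h1, h2, h3]
  push_cast
  ring

variable (H) in
/-- The vectors `ζ b` realize the kernel of `H`, normalized at `a`. -/
def NormalizedAt {E : Type*} [NormedAddCommGroup E] [InnerProductSpace ℂ E] (a : X) (ζ : X → E) :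
    Prop :=
  ∀ b c, inner ℂ (ζ b) (ζ c) = 1 - ratio H a b c

section NormalizedAt

variable {E : Type*} [NormedAddCommGroup E] [InnerProductSpace ℂ E] {a : X} {ζ : X → E}

theorem NormalizedAt.norm_eq (h : NormalizedAt H a ζ) (b : X) : ‖ζ b‖ = deltaH H a b := by
  have h1 : inner ℂ (ζ b) (ζ b) = ((‖ζ b‖ ^ 2 : ℝ) : ℂ) := by
    rw [inner_self_eq_norm_sq_to_K]
    norm_cast
  have h2 : ((‖ζ b‖ ^ 2 : ℝ) : ℂ) = ((deltaH H a b ^ 2 : ℝ) : ℂ) := by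
    rw [← h1, h, ratio_self]
    push_cast
    ring
  exact (pow_left_inj₀ (norm_nonneg _) (deltaH_nonneg _ _ _) two_ne_zero).mp
    (Complex.ofReal_injective h2)

theorem NormalizedAt.base (hH : IsIrreducible H) (h : NormalizedAt H a ζ) : ζ a = 0 := by
  rw [← inner_self_eq_zero (𝕜 := ℂ), h, hH.ratio_left, sub_self]

theorem IsIrreducible.one_sub_ratio (hH : IsIrreducible H) (a b c : X) :
    1 - ratio H a b c = (k H b c * k H a a - k H b a * k H a c) / (k H b c * k H a a) := by
  have := hH.k_ne_zero b c
  have := hH.k_ne_zero a a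
  rw [ratio]
  field_simp

theorem gramIneq_iff_ratio (hH : IsIrreducible H) (a b c : X) : GramIneq H a b c ↔
    ‖1 - ratio H a b c‖ ^ 2 ≤ deltaH H a b ^ 2 * deltaH H a c ^ 2 := by
  have h1 := norm_pos_iff.mpr (hH.k_ne_zero b c)
  have h2 := norm_pos_iff.mpr (hH.k_ne_zero a a)
  rw [hH.one_sub_ratio, norm_div, norm_mul, div_pow, mul_pow, div_le_iff₀ (by positivity), GramIneq]

theorem NormalizedAt.gramIneq (hH : IsIrreducible H) (h : NormalizedAt H a ζ) (b c : X) :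
    GramIneq H a b c := by
  rw [gramIneq_iff_ratio hH, ← h, ← h.norm_eq, ← h.norm_eq, ← mul_pow]
  gcongr
  exact norm_inner_le_norm _ _

end NormalizedAt

theorem inner_pair (a b c d : ℂ) : inner ℂ !₂[a, b] !₂[c, d] = c * conj a + d * conj b := by
  simp [PiLp.inner_apply]

theorem exists_normalizedAt (hH : IsIrreducible H) (x : Fin 3 ≃ X)
    (h : GramIneq H (x 0) (x 1) (x 2)) :
    ∃ (s : ℝ) (w : ℂ) (t : ℝ) (Φ : X → Ball 2), IsNormalTriple x Φ s w t ∧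
      NormalizedAt H (x 0) (fun b => (Φ b : EuclideanSpace ℂ (Fin 2))) := by
  rw [gramIneq_iff_ratio hH] at h
  have hs : 0 < deltaH H (x 0) (x 1) := hH.deltaH_pos (by simp)
  set s := deltaH H (x 0) (x 1)
  set g := 1 - ratio H (x 0) (x 1) (x 2) with hg
  -- Forced by ⟨(s,0), (w,t)⟩ = g; the inequality says |w| ≤ r, which leaves room for t with |w|² +
  -- t² = r².
  set w : ℂ := g / s
  set r := deltaH H (x 0) (x 2)
  have hw : ‖w‖ ^ 2 ≤ r ^ 2 := by
    rw [norm_div, div_pow, Complex.norm_real, Real.norm_of_nonneg hs.le, div_le_iff₀ (by positivity),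
      mul_comm]
    exact h
  set t := √(r ^ 2 - ‖w‖ ^ 2)
  have ht : t ^ 2 = r ^ 2 - ‖w‖ ^ 2 := Real.sq_sqrt (sub_nonneg.mpr hw)
  have hsw : s * w = g := by
    have : (s : ℂ) ≠ 0 := by exact_mod_cast hs.ne'
    exact mul_div_cancel₀ _ this
  let v : Fin 3 → EuclideanSpace ℂ (Fin 2) := ![!₂[0, 0], !₂[(s : ℂ), 0], !₂[w, (t : ℂ)]]
  have h12 : inner ℂ (v 1) (v 2) = g := by
    rw [← hsw]
    simp [v, PiLp.inner_apply, mul_comm]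
  have hin : ∀ i j, inner ℂ (v i) (v j) = 1 - ratio H (x 0) (x i) (x j) := by
    have h0 : ∀ j, inner ℂ (v 0) (v j) = 1 - ratio H (x 0) (x 0) (x j) := fun j => by
      rw [hH.ratio_left, sub_self]
      simp [v, PiLp.inner_apply]
    have h0' : ∀ j, inner ℂ (v j) (v 0) = 1 - ratio H (x 0) (x j) (x 0) := fun j => by
      rw [hH.ratio_right, sub_self]
      simp [v, PiLp.inner_apply]
    have h11 : inner ℂ (v 1) (v 1) = 1 - ratio H (x 0) (x 1) (x 1) := by
      rw [ratio_self]
      change inner ℂ !₂[(s : ℂ), 0] !₂[(s : ℂ), 0] = 1 - ((1 - s ^ 2 : ℝ) : ℂ)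
      rw [inner_pair]
      simp [sq]
    have h22 : inner ℂ (v 2) (v 2) = 1 - ratio H (x 0) (x 2) (x 2) := by
      rw [ratio_self]
      change inner ℂ !₂[w, (t : ℂ)] !₂[w, (t : ℂ)] = 1 - ((1 - r ^ 2 : ℝ) : ℂ)
      have : r ^ 2 = ‖w‖ ^ 2 + t ^ 2 := by rw [ht]; ring
      rw [this, inner_pair, Complex.mul_conj, Complex.normSq_eq_norm_sq]
      simp [sq]
    have h21 : inner ℂ (v 2) (v 1) = 1 - ratio H (x 0) (x 2) (x 1) := by
      rw [← inner_conj_symm, h12, hg, map_sub, map_one, conj_ratio]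
    intro i j
    fin_cases i
    · exact h0 j
    · fin_cases j
      exacts [h0' 1, h11, h12]
    · fin_cases j
      exacts [h0' 2, h21, h22]
  have hnorm : NormalizedAt H (x 0) (fun b => v (x.symm b)) := fun b c => by
    simpa using hin (x.symm b) (x.symm c)
  refine ⟨s, w, t, fun b => ⟨v (x.symm b), ?_⟩, ⟨hs, Real.sqrt_nonneg _, ?_, ?_, ?_⟩, hnorm⟩
  · rw [mem_ball_zero_iff, hnorm.norm_eq, ← sq_lt_one_iff₀ (deltaH_nonneg _ _ _)]
    exact hH.deltaH_sq_lt_one _ _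
  all_goals simp [v]

/-- The extension theorem needs the transposed kernel, since inner products of kernel vectors
reverse the indices. Conjugating coordinates transposes the Gram matrix. -/
theorem NormalizedAt.exists_conj (hH : IsIrreducible H) {n : ℕ} {a : X}
    {ζ : X → EuclideanSpace ℂ (Fin n)} (h : NormalizedAt H a ζ) :
    ∃ (ξ : X → EuclideanSpace ℂ (Fin n)) (c : X → ℂ), ξ a = 0 ∧ (∀ b, c b ≠ 0) ∧
      ∀ b b', k H b' b * (1 - inner ℂ (ξ b) (ξ b')) = conj (c b) * c b' := by
  have ha : (‖kvec H a‖ : ℂ) ≠ 0 := by exact_mod_cast (hH.norm_kvec_pos a).ne'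
  refine ⟨fun b => WithLp.toLp 2 fun i => conj (ζ b i), fun b => k H b a / (‖kvec H a‖ : ℂ), ?_,
    fun b => div_ne_zero (hH.k_ne_zero _ _) ha, fun b b' => ?_⟩
  · ext i
    simp [h.base hH]
  · have h1 : inner ℂ (WithLp.toLp 2 fun i => conj (ζ b i) : EuclideanSpace ℂ (Fin n))
        (WithLp.toLp 2 fun i => conj (ζ b' i)) = inner ℂ (ζ b') (ζ b) := by
      simp only [PiLp.inner_apply, RCLike.inner_apply, Complex.conj_conj]
      exact Finset.sum_congr rfl fun i _ => mul_comm _ _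
    have h2 := hH.k_ne_zero b' b
    rw [h1, h, sub_sub_cancel, ratio, map_div₀, conj_k, Complex.conj_ofReal, k_self]
    push_cast
    field_simp

theorem isRealization_iff [Finite X] {n : ℕ} (Φ : X → Ball n) :
    IsRealization H Φ ↔ Function.Injective Φ ∧ ∃ γ : X → ℂ, (∀ x, γ x ≠ 0) ∧
      ∀ b c, (1 - inner ℂ (Φ b : EuclideanSpace ℂ (Fin n)) (Φ c : EuclideanSpace ℂ (Fin n)))⁻¹ =
        γ b * conj (γ c) * k H b c := by
  constructor
  · rintro ⟨e, he, γ, hγ, h⟩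
    refine ⟨fun b c hbc => e.injective (Subtype.ext (by rw [he, he, hbc])), γ, hγ, fun b c => ?_⟩
    rw [← h, k_kerSpan, he, he, kDA]
  · rintro ⟨hΦ, γ, hγ, h⟩
    refine ⟨Equiv.ofInjective Φ hΦ, fun a => rfl, γ, hγ, fun b c => ?_⟩
    rw [← h, k_kerSpan, kDA]
    rfl

theorem one_sub_inner_ne_zero {n : ℕ} (z w : Ball n) :
    1 - inner ℂ (w : EuclideanSpace ℂ (Fin n)) (z : EuclideanSpace ℂ (Fin n)) ≠ 0 := fun h => by
  have := norm_inner_ball_lt z w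
  rw [← sub_eq_zero.mp h, norm_one] at this
  exact lt_irrefl _ this

theorem NormalizedAt.isRealization [Finite X] (hH : IsIrreducible H) {n : ℕ} {a : X}
    {Φ : X → Ball n} (h : NormalizedAt H a fun b => (Φ b : EuclideanSpace ℂ (Fin n))) :
    IsRealization H Φ := by
  have ha : (‖kvec H a‖ : ℂ) ≠ 0 := by exact_mod_cast (hH.norm_kvec_pos a).ne'
  rw [isRealization_iff]
  refine ⟨fun b c hbc => ?_, fun b => ‖kvec H a‖ / k H b a,
    fun b => div_ne_zero ha (hH.k_ne_zero _ _), fun b c => ?_⟩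
  -- If Φ b = Φ c, the ratios at (b,b), (b,c), (c,c) agree, hence |k_bc|² = k_bb k_cc and δ_bc = 0,
  -- contrary to independence of the kernels.
  · by_contra hne
    have h1 : ratio H a b c = ratio H a b b := by
      have e1 := h b b
      have e2 := h b c
      simp only [← hbc] at e1 e2
      rw [e1] at e2
      linear_combination e2
    have h2 : ratio H a b c = ratio H a c c := by
      have e1 := h c c
      have e2 := h b c
      simp only [hbc] at e1 e2
      rw [e1] at e2
      linear_combination e2
    have h3 : ratio H a c b = ratio H a b c := by
      rw [← conj_ratio, h1, ratio_self, Complex.conj_ofReal]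
    have h4 : ratio H a b b * ratio H a c c = ratio H a b c * ratio H a c b := by
      rw [h3, ← h1, ← h2]
    have h5 : k H b c * k H c b = k H b b * k H c c := by
      have := hH.k_ne_zero
      have e1 := this b a
      have e2 := this a b
      have e3 := this c a
      have e4 := this a c
      have e5 := this a a
      have e6 := this b b
      have e7 := this c c
      have e8 := this b c
      have e9 := this c b
      simp only [ratio] at h4
      field_simp at h4
      exact h4
    have h6 := deltaH_sq' H b c
    rw [k_mul_k_comm, k_self, k_self] at h5
    norm_cast at h5
    have hb := hH.norm_kvec_pos b
    have hc := hH.norm_kvec_pos c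
    rw [h5, div_self (by positivity), sub_self] at h6
    have := hH.deltaH_pos hne
    exact (pow_pos this 2).ne' h6
  · rw [h, sub_sub_cancel, ratio, inv_div, map_div₀, conj_k, Complex.conj_ofReal, k_self H a]
    push_cast
    field_simp

theorem IsRealization.ratio_eq [Finite X] {n : ℕ} {Φ : X → Ball n} (h : IsRealization H Φ)
    (a b c : X) : ratio H a b c =
      (1 - inner ℂ (Φ a : EuclideanSpace ℂ (Fin n)) (Φ a : EuclideanSpace ℂ (Fin n))) *
      (1 - inner ℂ (Φ b : EuclideanSpace ℂ (Fin n)) (Φ c : EuclideanSpace ℂ (Fin n))) /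
      ((1 - inner ℂ (Φ b : EuclideanSpace ℂ (Fin n)) (Φ a : EuclideanSpace ℂ (Fin n))) *
      (1 - inner ℂ (Φ a : EuclideanSpace ℂ (Fin n)) (Φ c : EuclideanSpace ℂ (Fin n)))) := by
  obtain ⟨-, γ, hγ, h⟩ := (isRealization_iff Φ).mp h
  have h1 : ∀ b c, k H b c = (γ b)⁻¹ * (conj (γ c))⁻¹ *
      (1 - inner ℂ (Φ b : EuclideanSpace ℂ (Fin n)) (Φ c : EuclideanSpace ℂ (Fin n)))⁻¹ := by
    intro b c
    have := hγ b
    have h2 : conj (γ c) ≠ 0 := by simpa using hγ c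
    rw [h]
    field_simp
  have h2 : ∀ b, conj (γ b) ≠ 0 := fun b => by simpa using hγ b
  have e1 := hγ a
  have e2 := hγ b
  have e3 := h2 a
  have e4 := h2 c
  have e5 := one_sub_inner_ne_zero (Φ a) (Φ a)
  have e6 := one_sub_inner_ne_zero (Φ c) (Φ b)
  have e7 := one_sub_inner_ne_zero (Φ a) (Φ b)
  have e8 := one_sub_inner_ne_zero (Φ c) (Φ a)
  rw [ratio, h1, h1, h1, h1]
  field_simp

theorem IsRealization.normalizedAt [Finite X] {n : ℕ} {Φ : X → Ball n} (h : IsRealization H Φ)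
    {a : X} (ha : (Φ a : EuclideanSpace ℂ (Fin n)) = 0) :
    NormalizedAt H a fun b => (Φ b : EuclideanSpace ℂ (Fin n)) := fun b c => by
  rw [h.ratio_eq, ha]
  simp

end NormalForm

/-! ### Rescaling and the four invariants. -/

section Rescaling

variable {X X' : Type*} {H H' : Type*} [NormedAddCommGroup H] [InnerProductSpace ℂ H]
  [CompleteSpace H] [RKHS ℂ H X ℂ] [NormedAddCommGroup H'] [InnerProductSpace ℂ H']
  [CompleteSpace H'] [RKHS ℂ H' X' ℂ]

/-- Both spaces have the same kernel once normalized at a; γ is the quotient of the two normalizing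
factors. -/
theorem isRescaling_of_ratio_eq (hH : IsIrreducible H) (hH' : IsIrreducible H') (e : X ≃ X')
    (a : X) (h : ∀ b c, ratio H a b c = ratio H' (e a) (e b) (e c)) : IsRescaling H H' e := by
  have h1 := hH.k_ne_zero
  have h2 := hH'.k_ne_zero
  have ha : (‖kvec H a‖ : ℂ) ≠ 0 := by exact_mod_cast (hH.norm_kvec_pos a).ne'
  have ha' : (‖kvec H' (e a)‖ : ℂ) ≠ 0 := by exact_mod_cast (hH'.norm_kvec_pos (e a)).ne'
  refine ⟨fun b => k H' (e b) (e a) / k H b a * (‖kvec H a‖ / ‖kvec H' (e a)‖),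
    fun b => mul_ne_zero (div_ne_zero (h2 _ _) (h1 _ _)) (div_ne_zero ha ha'), fun b c => ?_⟩
  have h3 := h b c
  rw [ratio, ratio, div_eq_div_iff (mul_ne_zero (h1 _ _) (h1 _ _))
    (mul_ne_zero (h2 _ _) (h2 _ _)), k_self, k_self] at h3
  rw [map_mul, map_div₀, map_div₀, conj_k, conj_k, Complex.conj_ofReal, Complex.conj_ofReal]
  push_cast at h3
  have e1 := h1 b a
  have e2 := h1 a c
  field_simp
  linear_combination h3

theorem IsRescaling.norm_kHat_eq {e : X ≃ X'} (h : IsRescaling H H' e) (x y : X) :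
    ‖kHat H' (e x) (e y)‖ = ‖kHat H x y‖ := by
  obtain ⟨γ, hγ, h⟩ := h
  have h1 : ∀ z, ‖kvec H' (e z)‖ = ‖γ z‖ * ‖kvec H z‖ := fun z => by
    have : ‖kvec H' (e z)‖ ^ 2 = (‖γ z‖ * ‖kvec H z‖) ^ 2 := by
      rw [← norm_k_self, h, norm_mul, norm_mul, norm_k_self, RCLike.norm_conj]
      ring
    exact (pow_left_inj₀ (norm_nonneg _) (by positivity) two_ne_zero).mp this
  rw [norm_kHat, norm_kHat, h, h1, h1, norm_mul, norm_mul, RCLike.norm_conj]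
  have e1 := norm_ne_zero_iff.mpr (hγ x)
  have e2 := norm_ne_zero_iff.mpr (hγ y)
  rw [show ‖γ x‖ * ‖kvec H x‖ * (‖γ y‖ * ‖kvec H y‖) =
    ‖γ x‖ * ‖γ y‖ * (‖kvec H x‖ * ‖kvec H y‖) by ring, mul_div_mul_left _ _ (mul_ne_zero e1 e2)]

theorem IsRescaling.deltaH_eq {e : X ≃ X'} (h : IsRescaling H H' e) (x y : X) :
    deltaH H' (e x) (e y) = deltaH H x y := by
  rw [deltaH, deltaH, h.norm_kHat_eq]

theorem IsRescaling.angular_eq {e : X ≃ X'} (h : IsRescaling H H' e) (x y z : X) :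
    angular H' (e x) (e y) (e z) = angular H x y z := by
  obtain ⟨γ, hγ, h⟩ := h
  have h1 : k H' (e x) (e y) * k H' (e y) (e z) * k H' (e z) (e x) =
      ((‖γ x‖ ^ 2 * ‖γ y‖ ^ 2 * ‖γ z‖ ^ 2 : ℝ) : ℂ) * (k H x y * k H y z * k H z x) := by
    rw [h, h, h]
    push_cast
    simp only [← RCLike.ofReal_eq_complex_ofReal, ← RCLike.mul_conj]
    ring
  have h2 : ∀ x, 0 < ‖γ x‖ := fun x => norm_pos_iff.mpr (hγ x)
  have := h2 x
  have := h2 y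
  have := h2 z
  rw [angular, angular, h1, Complex.arg_real_mul _ (by positivity)]

theorem norm_kHat_eq_of_deltaH_eq {x y : X} {x' y' : X'} (h : deltaH H x y = deltaH H' x' y') :
    ‖kHat H x y‖ = ‖kHat H' x' y'‖ := by
  have h1 := deltaH_sq H x y
  rw [h, deltaH_sq] at h1
  exact (pow_left_inj₀ (norm_nonneg _) (norm_nonneg _) two_ne_zero).mp (by linarith)

theorem ratio_eq_of_invariants_eq (hH : IsIrreducible H) (hH' : IsIrreducible H')
    {x : Fin 3 ≃ X} {x' : Fin 3 ≃ X'} (h : invariants H x = invariants H' x') (i j : Fin 3) :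
    ratio H (x 0) (x i) (x j) = ratio H' (x' 0) (x' i) (x' j) := by
  simp only [invariants, Prod.mk.injEq] at h
  obtain ⟨h1, h2, h3, h4⟩ := h
  have h12 : ratio H (x 0) (x 1) (x 2) = ratio H' (x' 0) (x' 1) (x' 2) := by
    rw [hH.ratio_eq_angular, hH'.ratio_eq_angular, h4, norm_kHat_eq_of_deltaH_eq h1,
      norm_kHat_eq_of_deltaH_eq h2, norm_kHat_eq_of_deltaH_eq h3]
  fin_cases i
  · exact (hH.ratio_left _ _).trans (hH'.ratio_left _ _).symm
  · fin_cases j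
    · exact (hH.ratio_right _ _).trans (hH'.ratio_right _ _).symm
    · exact (ratio_self _ _).trans ((congrArg (fun r : ℝ => ((1 - r ^ 2 : ℝ) : ℂ)) h1).trans (ratio_self _ _).symm)
    · exact h12
  · fin_cases j
    · exact (hH.ratio_right _ _).trans (hH'.ratio_right _ _).symm
    · exact (conj_ratio _ _ _).symm.trans ((congrArg _ h12).trans (conj_ratio _ _ _))
    · exact (ratio_self _ _).trans ((congrArg (fun r : ℝ => ((1 - r ^ 2 : ℝ) : ℂ)) h2).trans (ratio_self _ _).symm)

theorem invariants_eq_iff (hH : IsIrreducible H) (hH' : IsIrreducible H')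
    (x : Fin 3 ≃ X) (x' : Fin 3 ≃ X') :
    invariants H x = invariants H' x' ↔ IsRescaling H H' (x.symm.trans x') := by
  refine ⟨fun h => isRescaling_of_ratio_eq hH hH' _ (x 0) fun b c => ?_, fun h => ?_⟩
  · simpa using ratio_eq_of_invariants_eq hH hH' h (x.symm b) (x.symm c)
  · have h1 : ∀ i, x' i = (x.symm.trans x') (x i) := fun i => by simp
    simp only [invariants, h1]
    rw [h.deltaH_eq, h.deltaH_eq, h.deltaH_eq, h.angular_eq]

end Rescaling

/-! ### Uniqueness of the normal triple. -/

section Uniqueness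

variable {X X' : Type*}

theorem IsNormalTriple.eq_of_inner_eq {x : Fin 3 ≃ X} {x' : Fin 3 ≃ X'} {s s' : ℝ} {w w' : ℂ}
    {t t' : ℝ} {Φ : X → Ball 2} {Φ' : X' → Ball 2} (h : IsNormalTriple x Φ s w t)
    (h' : IsNormalTriple x' Φ' s' w' t')
    (hin : ∀ i j, inner ℂ (Φ (x i) : EuclideanSpace ℂ (Fin 2)) (Φ (x j) : EuclideanSpace ℂ (Fin 2)) =
      inner ℂ (Φ' (x' i) : EuclideanSpace ℂ (Fin 2)) (Φ' (x' j) : EuclideanSpace ℂ (Fin 2)))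
    (i : Fin 3) : Φ (x i) = Φ' (x' i) := by
  obtain ⟨hs, ht, h0, h1, h2⟩ := h
  obtain ⟨hs', ht', h0', h1', h2'⟩ := h'
  have e11 := hin 1 1
  have e12 := hin 1 2
  have e22 := hin 2 2
  rw [h1, h1', inner_pair, inner_pair] at e11
  rw [h1, h1', h2, h2', inner_pair, inner_pair] at e12
  rw [h2, h2', inner_pair, inner_pair] at e22
  simp only [map_zero, mul_zero, add_zero, Complex.conj_ofReal] at e11 e12 e22
  have es : s = s' := by
    norm_cast at e11
    nlinarith
  subst es
  have ew : w = w' := mul_right_cancel₀ (by exact_mod_cast hs.ne') e12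
  subst ew
  have et : t = t' := by
    have e3 := add_left_cancel e22
    norm_cast at e3
    nlinarith
  subst et
  apply Subtype.ext
  fin_cases i
  · exact h0.trans h0'.symm
  · exact h1.trans h1'.symm
  · exact h2.trans h2'.symm

end Uniqueness

/-! ### Involutive automorphisms of the ball. -/

section Moebius

variable {E : Type*} [NormedAddCommGroup E] [InnerProductSpace ℂ E]

/-- The involutive automorphism of the unit ball that exchanges `a` and `0`. -/
def moebius (a z : E) : E :=
  (1 - inner ℂ a z)⁻¹ •
    ((1 - inner ℂ a z / (1 + √(1 - ‖a‖ ^ 2) : ℝ)) • a - (√(1 - ‖a‖ ^ 2) : ℂ) • z)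

theorem one_sub_inner_ne_zero_of_norm_lt_one {z w : E} (hz : ‖z‖ < 1) (hw : ‖w‖ < 1) :
    1 - inner ℂ z w ≠ 0 := fun h => by
  have h1 := norm_inner_le_norm (𝕜 := ℂ) z w
  rw [← sub_eq_zero.mp h, norm_one] at h1
  nlinarith [norm_nonneg z, norm_nonneg w]

theorem inner_self_eq_ofReal (v : E) : inner ℂ v v = ((‖v‖ ^ 2 : ℝ) : ℂ) := by
  rw [inner_self_eq_norm_sq_to_K]
  norm_cast

theorem ofReal_sqrt_sq {a : E} (ha : ‖a‖ < 1) :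
    (√(1 - ‖a‖ ^ 2) : ℂ) ^ 2 = 1 - inner ℂ a a := by
  have : √(1 - ‖a‖ ^ 2) ^ 2 = 1 - ‖a‖ ^ 2 :=
    Real.sq_sqrt (by nlinarith [norm_nonneg a])
  rw [inner_self_eq_ofReal, ← Complex.ofReal_pow, this, Complex.ofReal_sub, Complex.ofReal_one]

/-- With s = √(1 - ‖a‖²), `moebius` uses 1/(1+s) in place of (1-s)/‖a‖² in the projection onto a, so
a = 0 needs no separate case. -/
theorem one_add_sqrt_ne_zero {E : Type*} [NormedAddCommGroup E] (a : E) : (1 + √(1 - ‖a‖ ^ 2) : ℂ) ≠ 0 := by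
  have : 0 < 1 + √(1 - ‖a‖ ^ 2) := by positivity
  exact_mod_cast this.ne'

theorem one_sub_inner_moebius {a z w : E} (ha : ‖a‖ < 1) (hz : ‖z‖ < 1) (hw : ‖w‖ < 1) :
    1 - inner ℂ (moebius a z) (moebius a w) =
      (1 - inner ℂ a a) * (1 - inner ℂ z w) / ((1 - inner ℂ z a) * (1 - inner ℂ a w)) := by
  have h1 := one_sub_inner_ne_zero_of_norm_lt_one hz ha
  have h2 := one_sub_inner_ne_zero_of_norm_lt_one ha hw
  have h3 := one_add_sqrt_ne_zero a
  have h4 : inner ℂ a a = 1 - (√(1 - ‖a‖ ^ 2) : ℂ) ^ 2 := by rw [ofReal_sqrt_sq ha]; ring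
  simp only [moebius, inner_smul_left, inner_smul_right, inner_sub_left, inner_sub_right, map_sub, map_add,
    map_inv₀, map_div₀, map_one, Complex.conj_ofReal, inner_conj_symm, h4, Complex.ofReal_add,
    Complex.ofReal_one]
  generalize (√(1 - ‖a‖ ^ 2) : ℂ) = s at *
  field_simp
  ring

theorem inner_moebius {a z : E} (ha : ‖a‖ < 1) (hz : ‖z‖ < 1) :
    1 - inner ℂ a (moebius a z) = (1 - inner ℂ a a) / (1 - inner ℂ a z) := by
  have h2 := one_sub_inner_ne_zero_of_norm_lt_one ha hz
  have h3 := one_add_sqrt_ne_zero a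
  have h4 : inner ℂ a a = 1 - (√(1 - ‖a‖ ^ 2) : ℂ) ^ 2 := by rw [ofReal_sqrt_sq ha]; ring
  simp only [moebius, inner_smul_right, inner_sub_right, h4, Complex.ofReal_add,
    Complex.ofReal_one]
  generalize (√(1 - ‖a‖ ^ 2) : ℂ) = s at *
  field_simp
  ring

theorem moebius_moebius {a z : E} (ha : ‖a‖ < 1) (hz : ‖z‖ < 1) :
    moebius a (moebius a z) = z := by
  have h1 := one_sub_inner_ne_zero_of_norm_lt_one ha ha
  have h2 := one_sub_inner_ne_zero_of_norm_lt_one ha hz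
  have h3 := one_add_sqrt_ne_zero a
  have h4 := ofReal_sqrt_sq ha
  have h5 : inner ℂ a (moebius a z) = 1 - (1 - inner ℂ a a) / (1 - inner ℂ a z) := by
    rw [← inner_moebius ha hz]
    ring
  rw [moebius, h5]
  simp only [moebius, Complex.ofReal_add, Complex.ofReal_one]
  rw [← h4] at h1 ⊢
  generalize (√(1 - ‖a‖ ^ 2) : ℂ) = s at *
  have hs : s ≠ 0 := fun h => h1 (by rw [h]; ring)
  match_scalars
  · field_simp
    ring
  · field_simp
    ring

theorem norm_moebius_lt {a z : E} (ha : ‖a‖ < 1) (hz : ‖z‖ < 1) : ‖moebius a z‖ < 1 := by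
  have h := one_sub_inner_moebius ha hz hz
  have h1 : (1 - inner ℂ z a) * (1 - inner ℂ a z) = ((‖1 - inner ℂ a z‖ ^ 2 : ℝ) : ℂ) := by
    rw [← inner_conj_symm z a, ← Complex.normSq_eq_norm_sq, Complex.normSq_eq_conj_mul_self]
    simp
  have h2 : ∀ v : E, 1 - inner ℂ v v = ((1 - ‖v‖ ^ 2 : ℝ) : ℂ) := fun v => by
    rw [inner_self_eq_ofReal, Complex.ofReal_sub, Complex.ofReal_one]
  rw [h1, h2, h2, h2] at h
  norm_cast at h
  have h3 := norm_pos_iff.mpr (one_sub_inner_ne_zero_of_norm_lt_one ha hz)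
  have h4 : 0 < 1 - ‖a‖ ^ 2 := by nlinarith [norm_nonneg a]
  have h5 : 0 < 1 - ‖z‖ ^ 2 := by nlinarith [norm_nonneg z]
  have h6 : 0 < 1 - ‖moebius a z‖ ^ 2 := by rw [h]; positivity
  nlinarith [norm_nonneg (moebius a z)]

theorem differentiableOn_moebius {a : E} (ha : ‖a‖ < 1) :
    DifferentiableOn ℂ (moebius a) (Metric.ball 0 1) := by
  have h1 : Differentiable ℂ fun z : E => inner ℂ a z := (innerSL ℂ a).differentiable
  refine DifferentiableOn.smul (DifferentiableOn.inv ?_ fun z hz => ?_) ?_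
  · exact (h1.const_sub 1).differentiableOn
  · exact one_sub_inner_ne_zero_of_norm_lt_one ha (mem_ball_zero_iff.mp hz)
  · refine Differentiable.differentiableOn ?_
    simp only [div_eq_mul_inv]
    exact (((h1.mul_const _).const_sub 1).smul_const a).sub (differentiable_id.const_smul _)

end Moebius

/-! ### Congruence of systems of points. -/

section Congruence

variable {n : ℕ}

theorem IsHolomorphic.comp {f g : Ball n → Ball n} (hf : IsHolomorphic f) (hg : IsHolomorphic g) :
    IsHolomorphic (f ∘ g) := by
  obtain ⟨F, hF, hF'⟩ := hf
  obtain ⟨G, hG, hG'⟩ := hg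
  refine ⟨F ∘ G, hF.comp hG fun z hz => ?_, fun z => ?_⟩
  · rw [hG' ⟨z, hz⟩]
    exact (g ⟨z, hz⟩).2
  · rw [Function.comp_apply, hG', hF']
    rfl

theorem BallCongruent.symm {ι : Type*} {p q : ι → Ball n} (h : BallCongruent p q) :
    BallCongruent q p := by
  obtain ⟨φ, h1, h2, h3⟩ := h
  exact ⟨φ.symm, h2, h1, fun i => by rw [← h3, Equiv.symm_apply_apply]⟩

theorem BallCongruent.trans {ι : Type*} {p q r : ι → Ball n} (h : BallCongruent p q)
    (h' : BallCongruent q r) : BallCongruent p r := by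
  obtain ⟨φ, h1, h2, h3⟩ := h
  obtain ⟨ψ, h1', h2', h3'⟩ := h'
  exact ⟨φ.trans ψ, h1'.comp h1, h2.comp h2', fun i => by
    rw [Equiv.trans_apply, h3, h3']⟩

/-- `moebius a` as a permutation of the ball. -/
def ballMoebius (a : Ball n) : Ball n ≃ Ball n :=
  Function.Involutive.toPerm
    (fun z => ⟨moebius a z, mem_ball_zero_iff.mpr
      (norm_moebius_lt (mem_ball_zero_iff.mp a.2) (mem_ball_zero_iff.mp z.2))⟩)
    fun z => Subtype.ext (moebius_moebius (mem_ball_zero_iff.mp a.2) (mem_ball_zero_iff.mp z.2))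

theorem ballCongruent_ballMoebius {ι : Type*} (a : Ball n) (p : ι → Ball n) :
    BallCongruent p fun i => ballMoebius a (p i) :=
  have h : IsHolomorphic (ballMoebius a) :=
    ⟨_, differentiableOn_moebius (mem_ball_zero_iff.mp a.2), fun _ => rfl⟩
  ⟨ballMoebius a, h, h, fun _ => rfl⟩

/-- Equal Gram matrices give an isometry defined on the span of p, which finite dimension extends to
a unitary of E. -/
theorem exists_linearIsometryEquiv {ι E : Type*} [Finite ι] [NormedAddCommGroup E]
    [InnerProductSpace ℂ E] [FiniteDimensional ℂ E] (p q : ι → E)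
    (h : ∀ i j, inner ℂ (p i) (p j) = inner ℂ (q i) (q j)) :
    ∃ U : E ≃ₗᵢ[ℂ] E, ∀ i, U (p i) = q i := by
  classical
  have := Fintype.ofFinite ι
  let u : ∀ _ : ι → E, (ι → ℂ) →ₗ[ℂ] E := fun p => Fintype.linearCombination ℂ p
  have hu : ∀ c, ‖u p c‖ = ‖u q c‖ := fun c => by
    simp only [u, Fintype.linearCombination_apply]
    refine norm_sum_eq_of_inner _ _ _ fun i _ j _ => ?_
    simp only [inner_smul_left, inner_smul_right, h]
  obtain ⟨V, -, hV⟩ := exists_contraction_factor (u p) (u q) fun c => (hu c).ge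
  let L : LinearMap.range (u p) →ₗᵢ[ℂ] E :=
    ⟨V.toLinearMap ∘ₗ (LinearMap.range (u p)).subtype, by
      rintro ⟨_, c, rfl⟩
      exact (congrArg norm (hV c)).trans (hu c).symm⟩
  have hs : ∀ (p : ι → E) i, u p (Pi.single i 1) = p i := fun p i => by
    simp [u, Fintype.linearCombination_apply_single]
  refine ⟨L.extend.toLinearIsometryEquiv rfl, fun i => ?_⟩
  have h1 := L.extend_apply ⟨u p (Pi.single i 1), _, rfl⟩
  have h2 : L ⟨u p (Pi.single i 1), _, rfl⟩ = u q (Pi.single i 1) := hV _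
  rw [h2, hs q] at h1
  simpa [hs] using h1

theorem ballCongruent_of_inner_eq {ι : Type*} [Finite ι] (p q : ι → Ball n)
    (h : ∀ i j, inner ℂ (p i : EuclideanSpace ℂ (Fin n)) (p j : EuclideanSpace ℂ (Fin n)) =
      inner ℂ (q i : EuclideanSpace ℂ (Fin n)) (q j : EuclideanSpace ℂ (Fin n))) :
    BallCongruent p q := by
  obtain ⟨U, hU⟩ := exists_linearIsometryEquiv (fun i => (p i : EuclideanSpace ℂ (Fin n)))
    (fun i => (q i : EuclideanSpace ℂ (Fin n))) h
  refine ⟨⟨fun z => ⟨U z, by rw [mem_ball_zero_iff, U.norm_map]; exact mem_ball_zero_iff.mp z.2⟩,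
    fun z => ⟨U.symm z, by rw [mem_ball_zero_iff, U.symm.norm_map]; exact mem_ball_zero_iff.mp z.2⟩,
    fun z => by simp, fun z => by simp⟩, ⟨U, ?_, fun z => rfl⟩, ⟨U.symm, ?_, fun z => rfl⟩,
    fun i => Subtype.ext (hU i)⟩
  · exact U.toContinuousLinearEquiv.differentiable.differentiableOn
  · exact U.symm.toContinuousLinearEquiv.differentiable.differentiableOn

/-- The transformation law of 1 - ⟨z,w⟩ under the automorphism is exactly the normalization of the
kernel at a. -/
theorem IsRealization.normalizedAt_ballMoebius {X H : Type*} [Finite X] [NormedAddCommGroup H]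
    [InnerProductSpace ℂ H] [CompleteSpace H] [RKHS ℂ H X ℂ] {Φ : X → Ball n}
    (h : IsRealization H Φ) (a : X) :
    NormalizedAt H a fun b => (ballMoebius (Φ a) (Φ b) : EuclideanSpace ℂ (Fin n)) := by
  have h1 : ∀ b, ‖(Φ b : EuclideanSpace ℂ (Fin n))‖ < 1 := fun b => mem_ball_zero_iff.mp (Φ b).2
  intro b c
  rw [h.ratio_eq, ← one_sub_inner_moebius (h1 a) (h1 b) (h1 c), sub_sub_cancel]
  rfl

end Congruence

/-! ### Assembling the equivalences. -/

section Main

theorem zero_pair : (!₂[0, 0] : EuclideanSpace ℂ (Fin 2)) = 0 := by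
  ext i
  fin_cases i <;> rfl

variable {X : Type*} [Finite X] {H : Type*} [NormedAddCommGroup H] [InnerProductSpace ℂ H]
  [CompleteSpace H] [RKHS ℂ H X ℂ]

theorem hasCompletePick_of_symmIneq (hH : IsIrreducible H) (x : Fin 3 ≃ X)
    (h : SymmIneq H (x 0) (x 1) (x 2)) : HasCompletePick H := by
  refine hasCompletePick_of_normal_form H (ι := Fin 2) fun a => ?_
  -- Relabel so that a comes first; the symmetric inequality survives any relabelling.
  let y : Fin 3 ≃ X := (Equiv.swap 0 (x.symm a)).trans x
  have hy : y 0 = a := by simp [y]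
  have hs : SymmIneq H (y 0) (y 1) (y 2) := SymmIneq.of_fin h
    ((Equiv.injective _).ne (by decide)) ((Equiv.injective _).ne (by decide))
    ((Equiv.injective _).ne (by decide))
  obtain ⟨s, w, t, Φ, -, hΦ⟩ := exists_normalizedAt hH y ((gramIneq_iff_symmIneq hH _ _ _).mpr hs)
  rw [hy] at hΦ
  exact hΦ.exists_conj hH

end Main

end FinRKHS

end

open FinRKHS in
theorem theorem5p3 {X : Type*} [Finite X] (H : Type*) [NormedAddCommGroup H]
    [InnerProductSpace ℂ H] [CompleteSpace H] [RKHS ℂ H X ℂ]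
    (hH : FinRKHS.IsIrreducible H) (hdim : Module.finrank ℂ H = 3) (x : Fin 3 ≃ X) :
    List.TFAE
      [FinRKHS.HasCompletePick H,
       FinRKHS.HasPick H,
       ∃ i j : Fin 3, i ≠ j ∧ FinRKHS.deltaH H (x i) (x j) = FinRKHS.deltaG H (x i) (x j),
       FinRKHS.LFsq H (x 0) (x 1) (x 2) ≤ FinRKHS.deltaH H (x 0) (x 2) ^ 2,
       1 / ‖FinRKHS.kHat H (x 0) (x 1)‖ ^ 2 + 1 / ‖FinRKHS.kHat H (x 1) (x 2)‖ ^ 2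
           + 1 / ‖FinRKHS.kHat H (x 0) (x 2)‖ ^ 2 - 1
         ≤ 2 * Real.cos (FinRKHS.angular H (x 0) (x 1) (x 2)) /
           (‖FinRKHS.kHat H (x 0) (x 1)‖ * ‖FinRKHS.kHat H (x 1) (x 2)‖
             * ‖FinRKHS.kHat H (x 0) (x 2)‖),
       ∃ (s : ℝ) (w : ℂ) (t : ℝ) (Φ : X → FinRKHS.Ball 2),
         FinRKHS.IsNormalTriple x Φ s w t ∧ FinRKHS.IsRealization H Φ] ∧
    ∀ {X' : Type*} [Finite X'] (H' : Type*) [NormedAddCommGroup H'] [InnerProductSpace ℂ H']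
      [CompleteSpace H'] [RKHS ℂ H' X' ℂ]
      (_ : FinRKHS.IsIrreducible H') (_ : Module.finrank ℂ H' = 3) (x' : Fin 3 ≃ X'),
      (FinRKHS.invariants H x = FinRKHS.invariants H' x' ↔
        FinRKHS.IsRescaling H H' (x.symm.trans x')) ∧
      (FinRKHS.invariants H x = FinRKHS.invariants H' x' →
        (∀ (s s' : ℝ) (w w' : ℂ) (t t' : ℝ) (Φ : X → FinRKHS.Ball 2) (Φ' : X' → FinRKHS.Ball 2),
          FinRKHS.IsNormalTriple x Φ s w t → FinRKHS.IsRealization H Φ →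
          FinRKHS.IsNormalTriple x' Φ' s' w' t' → FinRKHS.IsRealization H' Φ' →
          ∀ i, Φ (x i) = Φ' (x' i)) ∧
        (∀ (n : ℕ) (Φ : X → FinRKHS.Ball n) (Φ' : X' → FinRKHS.Ball n),
          FinRKHS.IsRealization H Φ → FinRKHS.IsRealization H' Φ' →
          FinRKHS.BallCongruent (fun i => Φ (x i)) (fun i => Φ' (x' i)))) := by
  have : FiniteDimensional ℂ H := Module.finite_of_finrank_pos (by omega)
  refine ⟨?_, ?_⟩
  · tfae_have 1 → 2 := hasPick_of_hasCompletePick H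
    tfae_have 2 → 3 := fun h => ⟨0, 1, by simp, h.deltaH_eq_deltaG hH (by simp)⟩
    tfae_have 3 → 5 := by
      rintro ⟨i, j, hij, h⟩
      have hex : ∀ i j : Fin 3, ∃ l : Fin 3, l ≠ i ∧ l ≠ j := by decide
      obtain ⟨l, hl, hl'⟩ := hex i j
      have h1 := (gramIneq_iff_symmIneq hH _ _ _).mp (gramIneq_of_deltaH_eq_deltaG hH h (x l))
      rw [cos_ineq_iff hH]
      exact h1.to_fin hl'.symm hij.symm hl
    tfae_have 4 ↔ 5 := by
      rw [LFsq_le_iff hH _ (by simp), gramIneq_iff_symmIneq hH, cos_ineq_iff hH]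
    tfae_have 5 → 6 := by
      rw [cos_ineq_iff hH, ← gramIneq_iff_symmIneq hH]
      intro h
      obtain ⟨s, w, t, Φ, h1, h2⟩ := exists_normalizedAt hH x h
      exact ⟨s, w, t, Φ, h1, h2.isRealization hH⟩
    tfae_have 6 → 5 := by
      rintro ⟨s, w, t, Φ, ⟨-, -, h0, -⟩, h⟩
      rw [cos_ineq_iff hH, ← gramIneq_iff_symmIneq hH]
      exact (h.normalizedAt (h0.trans zero_pair)).gramIneq hH _ _
    tfae_have 5 → 1 := fun h => hasCompletePick_of_symmIneq hH x ((cos_ineq_iff hH _ _ _).mp h)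
    tfae_finish
  · intro X' _ H' _ _ _ _ hH' _ x'
    refine ⟨invariants_eq_iff hH hH' x x', fun hinv => ⟨?_, ?_⟩⟩
    · intro s s' w w' t t' Φ Φ' h1 h2 h1' h2' i
      refine h1.eq_of_inner_eq h1' (fun i j => ?_) i
      rw [h2.normalizedAt (h1.2.2.1.trans zero_pair),
        h2'.normalizedAt (h1'.2.2.1.trans zero_pair), ratio_eq_of_invariants_eq hH hH' hinv]
    · intro n Φ Φ' h h'
      -- Moving both first vertices to 0 leaves two triples with the same Gram matrix.
      refine (ballCongruent_ballMoebius (Φ (x 0)) _).trans (.trans ?_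
        (ballCongruent_ballMoebius (Φ' (x' 0)) _).symm)
      refine ballCongruent_of_inner_eq _ _ fun i j => ?_
      rw [h.normalizedAt_ballMoebius, h'.normalizedAt_ballMoebius,
        ratio_eq_of_invariants_eq hH hH' hinv]
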